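/- Let $\alpha\in(0,1)$ be irrational with continued fraction expansion $\alpha=[0;a_1,a_2,\dots]$ and convergent denominators $q_{-1}=0$, $q_0=1$, $q_{k+1}=a_{k+1}q_k+q_{k-1}$. Let $F_\alpha(t)=t+\alpha \bmod 1$ on $[0,1)$, let $I_0=[0,1-\alpha)$ and $I_1=[1-\alpha,1)$, and for a word $u=u_0\dots u_{n-1}$ over $\{0,1\}$ let $I_u=\bigcap_{k<n}F_\alpha^{-k}(I_{u_k})\subseteq[0,1)$ (with $I_u=[0,1)$ for the empty word). The Sturmian shift is $$\Sigma_\alpha=\{x\in\{0,1\}^{\mathbb N}\mid I_{x_0\dots x_{n-1}}\neq\emptyset\ \text{for all } n\in\mathbb N\},$$ with the shift map $\sigma(x)_i=x_{i+1}$. For $x\in\{0,1\}^{\mathbb N}$ let $[x(n)]=\{y\in\Sigma_\alpha\mid y_i=x_i\text{ for all }i<n\}$, for a set $C$ let $\tau(C)=\min\{k>0\mid \sigma^k(C)\cap C\neq\emptyset\}$ be its Poincaré return time (with $\tau(C)=\infty$ if there is no such $k$), and define $$\underline R(x)=\liminf_{n\to\infty}\frac{\tau([x(n)])}{n},\qquad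 \overline R(x)=\limsup_{n\to\infty}\frac{\tau([x(n)])}{n}.$$ Suppose that the sequence $(a_k)_{k\ge1}$ is bounded. Then there is exactly one $\sigma$-invariant Borel probability measure $\mu$ on $\Sigma_\alpha$, and for $\mu$-almost every $x\in\Sigma_\alpha$, $$\underline R(x)=\mathbf r_0:=\liminf_{k\to\infty}\frac{q_k}{q_{k+1}+q_k-1}\qquad\text{and}\qquad \overline R(x)=\mathbf r_1:=\limsup_{k\to\infty}\frac{q_{k+1}}{q_k}.$$ -/

import Mathlib

open MeasureTheory Filter Set
open scoped ENNReal

/-- The Poincaré return time `τ(M) = min {k > 0 | F^k(M) ∩ M ≠ ∅}` of a set `M` under a map `F`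
(it is `∞` if there is no such `k`). -/
noncomputable def returnTime {X : Type*} (F : X → X) (M : Set X) : ℝ≥0∞ :=
  ⨅ (k : ℕ) (_ : 0 < k ∧ (F^[k] '' M ∩ M).Nonempty), (k : ℝ≥0∞)

/-- The shift map on one-sided sequences, `(σ x)_i = x_{i+1}`. -/
def shiftMap {A : Type*} (x : ℕ → A) : ℕ → A := fun i => x (i + 1)

/-- The prefix `x(n) = x_0 x_1 … x_{n-1}`. -/
def seqPrefix {A : Type*} (x : ℕ → A) (n : ℕ) : Fin n → A := fun i => x i

/-- The cylinder `[u] = {y ∈ S | y_i = u_i for all i < |u|}` of a word `u` in the shift `S`. -/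
def shiftCylinder {A : Type*} (S : Set (ℕ → A)) {n : ℕ} (u : Fin n → A) : Set (ℕ → A) :=
  {y ∈ S | ∀ i : Fin n, y i = u i}

/-- The lower local return rate `liminf τ([x(n)]) / n`. -/
noncomputable def lowerReturnRate {A : Type*} (S : Set (ℕ → A)) (x : ℕ → A) : ℝ≥0∞ :=
  liminf (fun n : ℕ => returnTime shiftMap (shiftCylinder S (seqPrefix x n)) / (n : ℝ≥0∞)) atTop

/-- The upper local return rate `limsup τ([x(n)]) / n`. -/
noncomputable def upperReturnRate {A : Type*} (S : Set (ℕ → A)) (x : ℕ → A) : ℝ≥0∞ :=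
  limsup (fun n : ℕ => returnTime shiftMap (shiftCylinder S (seqPrefix x n)) / (n : ℝ≥0∞)) atTop

/-- The rotation `t ↦ t + α mod 1` of the circle, the circle being the interval `[0, 1)`. -/
noncomputable def circleRotation (α t : ℝ) : ℝ := Int.fract (t + α)

/-- The partition of the circle `[0, 1)` into `I_0 = [0, 1 - α)` and `I_1 = [1 - α, 1)`. -/
def letterInterval (α : ℝ) (i : Fin 2) : Set ℝ :=
  if i = 0 then Ico 0 (1 - α) else Ico (1 - α) 1

/-- `I_u`, the intersection of the sets `F_α^{-k}(I_{u_k})`, `k < |u|`, in the circle `[0, 1)`. -/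
def wordInterval (α : ℝ) {n : ℕ} (u : Fin n → Fin 2) : Set ℝ :=
  {t ∈ Ico (0 : ℝ) 1 | ∀ k : Fin n, (circleRotation α)^[k] t ∈ letterInterval α (u k)}

/-- The Sturmian shift `Σ_α`, a subset of `{0,1}^ℕ`. -/
def sturmianShift (α : ℝ) : Set (ℕ → Fin 2) :=
  {x | ∀ n : ℕ, (wordInterval α (seqPrefix x n)).Nonempty}

/-- `μ` is a shift-invariant Borel probability measure on the shift `S`, regarded as a measure on
the space of all sequences that is carried by `S`. -/
structure IsInvariantProbability (S : Set (ℕ → Fin 2)) (μ : Measure (ℕ → Fin 2)) : Prop where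
  isProbability : IsProbabilityMeasure μ
  carried : μ Sᶜ = 0
  invariant : MeasurePreserving shiftMap μ μ

/-- The denominator `q_k` of the `k`-th convergent of `α`: `q_0 = 1`, `q_1 = a_1`,
`q_{k+1} = a_{k+1} q_k + q_{k-1}`. -/
noncomputable def convDenom (α : ℝ) (k : ℕ) : ℝ := (GenContFract.of α).dens k

/-- `α = [a_0; a_1, a_2, …]` has bounded partial quotients `a_1, a_2, …`. -/
def HasBoundedPartialQuotients (α : ℝ) : Prop :=
  ∃ M : ℝ, ∀ (k : ℕ) (a : ℝ), (GenContFract.of α).partDens.get? k = some a → a ≤ M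

/-- The constant `r_0 = liminf q_k / (q_{k+1} + q_k - 1)`. -/
noncomputable def rateZero (α : ℝ) : ℝ≥0∞ :=
  liminf (fun k : ℕ =>
    ENNReal.ofReal (convDenom α k / (convDenom α (k + 1) + convDenom α k - 1))) atTop

/-- The constant `r_1 = limsup q_{k+1} / q_k`. -/
noncomputable def rateOne (α : ℝ) : ℝ≥0∞ :=
  limsup (fun k : ℕ => ENNReal.ofReal (convDenom α (k + 1) / convDenom α k)) atTop

/-! Write δ_k = q_k α - p_k. The letters of a coding are differences of consecutive floors ⌊t + jα⌋,
so a cylinder of length n corresponds to a cell: a half-open interval whose end points are cut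
points z - jα with j ≤ n. The return time of the cylinder is the least k > 0 for which some kα - z
is a difference of two points of the cell. Since |δ_k| is minimal among all |jα - r| with 0 < j <
q_{k+1}, return times are governed by comparing the cell with the |δ_k|.

Two bounds hold for every point. If n < q_{k+1}, each cell is longer than |δ_{k+1}|, so τ ≤ q_{k+1};
with q_k ≤ n this gives upper rate ≤ r_1. If n + 1 ≥ q_k + q_{k+1}, each cell is shorter than |δ_k|,
so τ ≥ q_{k+1}; this gives lower rate ≥ r_0.

For almost every point both are attained. A point midway between the cuts -jα and -(j + q_k)α with j
≤ εq_k has τ ≥ q_{k+1} already at n ≈ (1 + ε)q_k (`abs_sub_lt_of_sameCell`). A point next to a cut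
-jα with j slightly below q_{k+1} + q_{k+2} still has τ ≤ q_{k+1} for n just below j
(`exists_sameCell_add`). Bounded partial quotients keep q_k |δ_k| away from 0, so both kinds of
points fill sets of measure bounded below. Ergodicity then puts almost every orbit, up to a fixed
delay, in infinitely many of these sets; a fixed delay does not change limits of τ/n.

Unique ergodicity is carried over from the rotation: the coding is invertible off a single orbit,
which is null. -/

/-! ### Convergents and best approximation -/

/-- The fractions `p k / q k` behave like the convergents of `α`: they alternate around `α`,
consecutive ones have determinant `± 1`, and the errors `q k * α - p k` decrease accordingly. -/
structure IsConvergentSeq (α : ℝ) (q : ℕ → ℕ) (p : ℕ → ℤ) : Prop where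
  pos : ∀ k, 0 < q k
  mono : ∀ k, q k ≤ q (k + 1)
  add_le : ∀ k, q k + q (k + 1) ≤ q (k + 2)
  det : ∀ k, (q k : ℤ) * p (k + 1) - q (k + 1) * p k = 1 ∨
    (q k : ℤ) * p (k + 1) - q (k + 1) * p k = -1
  sign : ∀ k, (q k * α - p k) * (q (k + 1) * α - p (k + 1)) < 0
  gap : ∀ k, |q (k + 2) * α - p (k + 2)| + |q (k + 1) * α - p (k + 1)| ≤ |q k * α - p k|

namespace IsConvergentSeq

variable {α : ℝ} {q : ℕ → ℕ} {p : ℕ → ℤ}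

theorem abs_pos (h : IsConvergentSeq α q p) (k : ℕ) : 0 < |q k * α - p k| := by
  rw [_root_.abs_pos]
  intro h0
  have := h.sign k
  rw [h0] at this
  simp at this

theorem abs_lt (h : IsConvergentSeq α q p) (k : ℕ) :
    |q (k + 1) * α - p (k + 1)| < |q k * α - p k| := by
  have h1 := h.gap k
  have h2 := h.abs_pos (k + 2)
  linarith

/-- Best approximation: no multiple `j * α` with `0 < j < q (k + 1)` is closer to an integer than
`q k * α`. -/
theorem le_abs (h : IsConvergentSeq α q p) (k : ℕ) {j r : ℤ} (hj : 0 < j) (hjk : j < q (k + 1)) :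
    |q k * α - p k| ≤ |j * α - r| := by
  -- Determinant ±1 makes (q_k, p_k) and (q_{k+1}, p_{k+1}) a basis of ℤ²; Cramer's rule gives the
  -- coordinates.
  obtain ⟨x, y, hx, hy⟩ : ∃ x y : ℤ, j = x * q k + y * q (k + 1) ∧
      r = x * p k + y * p (k + 1) := by
    rcases h.det k with hd | hd
    · refine ⟨j * p (k + 1) - r * q (k + 1), r * q k - j * p k, ?_, ?_⟩
      · linear_combination -j * hd
      · linear_combination -r * hd
    · refine ⟨-(j * p (k + 1) - r * q (k + 1)), -(r * q k - j * p k), ?_, ?_⟩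
      · linear_combination j * hd
      · linear_combination r * hd
  have hq0 : (0 : ℤ) < q k := by exact_mod_cast h.pos k
  have hq1 : (0 : ℤ) < q (k + 1) := by exact_mod_cast h.pos (k + 1)
  have hxy : x * y ≤ 0 ∧ x ≠ 0 := by
    constructor
    · by_contra! hc
      rcases pos_and_pos_or_neg_and_neg_of_mul_pos hc with ⟨h1, h2⟩ | ⟨h1, h2⟩
      · nlinarith
      · nlinarith
    · rintro rfl
      rw [zero_mul, zero_add] at hx
      have : 0 < y := by
        by_contra! hc
        nlinarith
      nlinarith
  have e : (j : ℝ) * α - r = x * (q k * α - p k) + y * (q (k + 1) * α - p (k + 1)) := by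
    rw [hx, hy]; push_cast; ring
  have hs := h.sign k
  -- The coordinates have opposite signs, and so do the two errors: the terms cannot cancel.
  have habs : |(x : ℝ) * (q k * α - p k) + y * (q (k + 1) * α - p (k + 1))| =
      |(x : ℝ) * (q k * α - p k)| + |(y : ℝ) * (q (k + 1) * α - p (k + 1))| := by
    rw [abs_add_eq_add_abs_iff]
    have hp : 0 ≤ ((x : ℝ) * (q k * α - p k)) * (y * (q (k + 1) * α - p (k + 1))) := by
      have : (x : ℝ) * y ≤ 0 := by exact_mod_cast hxy.1
      nlinarith [mul_nonneg_of_nonpos_of_nonpos this hs.le]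
    rcases mul_nonneg_iff.1 hp with h1 | h1
    · exact Or.inl h1
    · exact Or.inr h1
  rw [e, habs, abs_mul]
  have : (1 : ℝ) ≤ |(x : ℝ)| := by exact_mod_cast Int.one_le_abs hxy.2
  nlinarith [h.abs_pos k, abs_nonneg ((y : ℝ) * (q (k + 1) * α - p (k + 1)))]

/-- The determinant equals q_{k+1} δ_k - q_k δ_{k+1}, and the errors have opposite signs. -/
theorem mul_add_mul (h : IsConvergentSeq α q p) (k : ℕ) :
    q (k + 1) * |q k * α - p k| + q k * |q (k + 1) * α - p (k + 1)| = 1 := by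
  have hd : (q k * (p (k + 1) : ℝ) - q (k + 1) * p k = 1) ∨
      (q k * (p (k + 1) : ℝ) - q (k + 1) * p k = -1) := by exact_mod_cast h.det k
  have h0 : (0 : ℝ) < q k := by exact_mod_cast h.pos k
  have h1 : (0 : ℝ) < q (k + 1) := by exact_mod_cast h.pos (k + 1)
  have hs := h.sign k
  rcases mul_neg_iff.1 hs with ⟨a, b⟩ | ⟨a, b⟩
  · rw [abs_of_pos a, abs_of_neg b]
    rcases hd with hd | hd
    · linarith
    · nlinarith
  · rw [abs_of_neg a, abs_of_pos b]
    rcases hd with hd | hd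
    · nlinarith
    · linarith

/-- The place where bounded partial quotients matter: this lower bound on q_k |δ_k| keeps the
measures in the almost-everywhere part away from 0. -/
theorem le_mul_abs (h : IsConvergentSeq α q p) {M : ℝ} (hM : ∀ k, (q (k + 1) : ℝ) ≤ M * q k)
    (k : ℕ) : 1 ≤ (M + 1) * (q k * |q k * α - p k|) := by
  have h0 : (0 : ℝ) < q k := by exact_mod_cast h.pos k
  have := h.mul_add_mul k
  nlinarith [h.abs_lt k, hM k, h.abs_pos k, mul_le_mul_of_nonneg_right (hM k) (h.abs_pos k).le]

theorem monotone (h : IsConvergentSeq α q p) : Monotone q := monotone_nat_of_le_succ h.mono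

theorem le_apply (h : IsConvergentSeq α q p) (k : ℕ) : k ≤ q k := by
  have : ∀ k, k ≤ q k ∧ k + 1 ≤ q (k + 1) := by
    intro k
    induction k with
    | zero => exact ⟨Nat.zero_le _, h.pos 1⟩
    | succ k ih =>
      have h1 : q k + q (k + 1) ≤ q (k + 1 + 1) := h.add_le k
      have h2 := h.pos k
      exact ⟨ih.2, by have := ih.2; omega⟩
  exact (this k).1

theorem tendsto_atTop (h : IsConvergentSeq α q p) : Tendsto q atTop atTop :=
  tendsto_atTop_mono h.le_apply tendsto_id

end IsConvergentSeq

/-! ### The continued fraction of α -/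

theorem not_terminatedAt_of_irrational {α : ℝ} (hirr : Irrational α) (n : ℕ) :
    ¬ (GenContFract.of α).TerminatedAt n := by
  intro hn
  obtain ⟨r, hr⟩ := (GenContFract.terminates_iff_rat α).1 ⟨n, hn⟩
  exact hirr ⟨r, hr.symm⟩

/-- The convergents of the continued fraction of an irrational number with bounded partial
quotients. -/
theorem exists_isConvergentSeq {α : ℝ} (hα0 : 0 < α) (hα1 : α < 1) (hirr : Irrational α)
    (hbdd : HasBoundedPartialQuotients α) :
    ∃ (q : ℕ → ℕ) (p : ℕ → ℤ), (∀ k, convDenom α k = q k) ∧ IsConvergentSeq α q p ∧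
      ∃ M : ℝ, 0 < M ∧ ∀ k, (q (k + 1) : ℝ) ≤ M * q k := by
  obtain ⟨M, hM⟩ := hbdd
  set g := GenContFract.of α with hg
  have hb : ∀ n, ∃ b : ℕ, 1 ≤ b ∧ (b : ℝ) ≤ M ∧ g.s.get? n = some ⟨1, b⟩ := by
    intro n
    obtain ⟨gp, hgp⟩ := Option.ne_none_iff_exists'.1 (not_terminatedAt_of_irrational hirr n)
    obtain ⟨h1, z, hz⟩ := GenContFract.of_partNum_eq_one_and_exists_int_partDen_eq hgp
    have h2 := GenContFract.partDen_eq_s_b hgp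
    have h3 := GenContFract.of_one_le_get?_partDen h2
    have h4 := hM n _ h2
    rw [hz] at h3 h4
    have h3' : 1 ≤ z := by exact_mod_cast h3
    lift z to ℕ using by omega
    refine ⟨z, by omega, by exact_mod_cast h4, ?_⟩
    rw [hg, hgp]
    congr 1
    cases gp
    simp_all
  choose b hb1 hbM hbs using hb
  -- `contsAux` is shifted by one: `B (n + 1)` is q_n, and `B 0 = 0` plays the role of q_{-1}.
  let A : ℕ → ℝ := fun n => (g.contsAux n).a
  let B : ℕ → ℝ := fun n => (g.contsAux n).b
  have hA : ∀ n, A (n + 2) = b n * A (n + 1) + A n := fun n => by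
    simp only [A]
    rw [GenContFract.contsAux_recurrence (hbs n) rfl rfl]; simp
  have hB : ∀ n, B (n + 2) = b n * B (n + 1) + B n := fun n => by
    simp only [B]
    rw [GenContFract.contsAux_recurrence (hbs n) rfl rfl]; simp
  have hfl : ⌊α⌋ = 0 := Int.floor_eq_zero_iff.2 ⟨hα0.le, hα1⟩
  have hA0 : A 0 = 1 := by simp [A, GenContFract.contsAux]
  have hB0 : B 0 = 0 := by simp [B, GenContFract.contsAux]
  have hA1 : A 1 = 0 := by simp [A, GenContFract.contsAux, hg, hfl]
  have hB1 : B 1 = 1 := by simp [B, GenContFract.contsAux]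
  have hint : ∀ n, (∃ z : ℕ, B n = z) ∧ (∃ z : ℕ, B (n + 1) = z) ∧ (∃ z : ℤ, A n = z) ∧
      ∃ z : ℤ, A (n + 1) = z := by
    intro n
    induction n with
    | zero => exact ⟨⟨0, by simp [hB0]⟩, ⟨1, by simp [hB1]⟩, ⟨1, by simp [hA0]⟩, ⟨0, by simp [hA1]⟩⟩
    | succ n ih =>
      obtain ⟨⟨z1, h1⟩, ⟨z2, h2⟩, ⟨z3, h3⟩, ⟨z4, h4⟩⟩ := ih
      refine ⟨⟨z2, h2⟩, ⟨b n * z2 + z1, ?_⟩, ⟨z4, h4⟩, ⟨b n * z4 + z3, ?_⟩⟩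
      · rw [hB, h1, h2]; push_cast; ring
      · rw [hA, h3, h4]; push_cast; ring
  choose q hq using fun n => (hint n).2.1
  choose p hp using fun n => (hint n).2.2.2
  -- Consecutive errors differ by the factor -f, with f the n-th fractional part of the Gauss
  -- algorithm. It comes from solving the exact value formula α = (A_n + f⁻¹ A_{n+1}) / (B_n + f⁻¹
  -- B_{n+1}), and yields alternating signs.
  have hfr : ∀ n, ∃ f : ℝ, 0 < f ∧ f < 1 ∧ B (n + 1) * α - A (n + 1) = -f * (B n * α - A n) ∧
      0 ≤ B n ∧ 0 < B (n + 1) := by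
    intro n
    have hst : ∀ m, ∃ i, GenContFract.IntFractPair.stream α m = some i := by
      intro m
      cases m with
      | zero => exact ⟨_, rfl⟩
      | succ m =>
        exact Option.ne_none_iff_exists'.1 fun hc => not_terminatedAt_of_irrational hirr m
          (GenContFract.of_terminatedAt_n_iff_succ_nth_intFractPair_stream_eq_none.2 hc)
    obtain ⟨i, hi⟩ := hst n
    obtain ⟨i', hi'⟩ := hst (n + 1)
    have hi0 : i.fr ≠ 0 := by
      obtain ⟨j, hj, hj0, -⟩ := GenContFract.IntFractPair.succ_nth_stream_eq_some_iff.1 hi'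
      rw [hi] at hj
      cases hj
      exact hj0
    have hnn : ∀ m, 0 ≤ B m := fun m => GenContFract.zero_le_of_contsAux_b
    have hpos : 0 < B (n + 1) := by
      have : ∀ m, 0 < B (m + 1) := by
        intro m
        induction m with
        | zero => rw [hB1]; norm_num
        | succ m ih =>
          have h1 : (1 : ℝ) ≤ b m := by exact_mod_cast hb1 m
          have := hB m
          nlinarith [hnn m]
      exact this n
    have hf0 : 0 < i.fr :=
      lt_of_le_of_ne (GenContFract.IntFractPair.nth_stream_fr_nonneg hi) (Ne.symm hi0)
    refine ⟨i.fr, hf0, GenContFract.IntFractPair.nth_stream_fr_lt_one hi, ?_, hnn n, hpos⟩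
    have h1 := GenContFract.compExactValue_correctness_of_stream_eq_some hi
    have h2 : α = (A n + i.fr⁻¹ * A (n + 1)) / (B n + i.fr⁻¹ * B (n + 1)) := by
      simpa [GenContFract.compExactValue, hi0, GenContFract.nextConts, GenContFract.nextNum,
        GenContFract.nextDen, add_comm, A, B] using! h1
    have h3 : 0 < B n + i.fr⁻¹ * B (n + 1) := by
      have := hnn n
      positivity
    rw [eq_div_iff h3.ne'] at h2
    have h4 : i.fr * i.fr⁻¹ = 1 := mul_inv_cancel₀ hi0
    linear_combination i.fr * h2 - (α * B (n + 1) - A (n + 1)) * h4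
  choose f hf0 hf1 hf hBn hBp using hfr
  have hne : ∀ n, B n * α - A n ≠ 0 := by
    intro n
    induction n with
    | zero => rw [hA0, hB0]; norm_num
    | succ n ih => rw [hf]; exact mul_ne_zero (neg_ne_zero.2 (hf0 n).ne') ih
  have hdet : ∀ n, B n * A (n + 1) - B (n + 1) * A n = 1 ∨
      B n * A (n + 1) - B (n + 1) * A n = -1 := by
    intro n
    induction n with
    | zero => right; rw [hA0, hB0, hA1, hB1]; norm_num
    | succ n ih =>
      rw [hA, hB]
      rcases ih with ih | ih
      · right; linear_combination -ih
      · left; linear_combination -ih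
  have hBmono : ∀ n, B (n + 1) + B n ≤ B (n + 2) := fun n => by
    have h1 : (1 : ℝ) ≤ b n := by exact_mod_cast hb1 n
    rw [hB]
    nlinarith [hBp n]
  refine ⟨q, p, ?_, ⟨?_, ?_, ?_, ?_, ?_, ?_⟩, M + 1, ?_, ?_⟩
  · intro k
    rw [← hq]
    rfl
  · intro k
    have := hBp k
    rw [hq] at this
    exact_mod_cast this
  · intro k
    have := hBmono k
    have h' : B (k + 1) ≤ B (k + 2) := by linarith [hBn k]
    rw [hq, hq] at h'
    exact_mod_cast h'
  · intro k
    have := hBmono (k + 1)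
    rw [hq, hq, hq] at this
    have h' : q (k + 1) + q k ≤ q (k + 2) := by exact_mod_cast this
    omega
  · intro k
    have := hdet (k + 1)
    rw [hq, hq, hp, hp] at this
    exact_mod_cast this
  · intro k
    rw [← hq, ← hq, ← hp, ← hp, hf (k + 1)]
    have := sq_pos_of_ne_zero (hne (k + 1))
    nlinarith [mul_pos (hf0 (k + 1)) this]
  · intro k
    rw [← hq, ← hq, ← hq, ← hp, ← hp, ← hp]
    have h1 : B (k + 1 + 2) * α - A (k + 1 + 2) =
        b (k + 1) * (B (k + 1 + 1) * α - A (k + 1 + 1)) + (B (k + 1) * α - A (k + 1)) := by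
      rw [hA, hB]; ring
    have e1 := hf (k + 1)
    have e2 := hf (k + 2)
    have g1 := hf0 (k + 1)
    have g2 := hf0 (k + 2)
    have hb' : (1 : ℝ) ≤ b (k + 1) := by exact_mod_cast hb1 (k + 1)
    rcases lt_or_gt_of_ne (hne (k + 1)) with hs | hs
    · have s1 : 0 < B (k + 1 + 1) * α - A (k + 1 + 1) := by rw [e1]; nlinarith
      have s2 : B (k + 1 + 2) * α - A (k + 1 + 2) < 0 := by
        rw [show k + 1 + 2 = k + 2 + 1 from rfl, e2]
        have : 0 < B (k + 2) * α - A (k + 2) := s1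
        nlinarith
      rw [show k + 2 + 1 = k + 1 + 2 from rfl, abs_of_neg hs, abs_of_pos s1, abs_of_neg s2, h1]
      nlinarith
    · have s1 : B (k + 1 + 1) * α - A (k + 1 + 1) < 0 := by rw [e1]; nlinarith
      have s2 : 0 < B (k + 1 + 2) * α - A (k + 1 + 2) := by
        rw [show k + 1 + 2 = k + 2 + 1 from rfl, e2]
        have : B (k + 2) * α - A (k + 2) < 0 := s1
        nlinarith
      rw [show k + 2 + 1 = k + 1 + 2 from rfl, abs_of_pos hs, abs_of_neg s1, abs_of_pos s2, h1]
      nlinarith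
  · have := hbM 0
    have h1 : (1 : ℝ) ≤ b 0 := by exact_mod_cast hb1 0
    linarith
  · intro k
    rw [← hq, ← hq, hB]
    have h1 : B k ≤ B (k + 1) := by
      cases k with
      | zero => rw [hB0, hB1]; norm_num
      | succ k => linarith [hBmono k, hBn k]
    nlinarith [hbM k, hBp k, mul_le_mul_of_nonneg_right (hbM k) (hBp k).le]

/-! ### Distribution of the points z - jα -/

namespace IsConvergentSeq

variable {α : ℝ} {q : ℕ → ℕ} {p : ℕ → ℤ}

theorem exists_abs_lt (h : IsConvergentSeq α q p) {ε : ℝ} (hε : 0 < ε) :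
    ∃ k, |q k * α - p k| < ε := by
  obtain ⟨n, hn⟩ := exists_nat_gt (1 / ε)
  refine ⟨n, ?_⟩
  have h1 := h.mul_add_mul n
  have h2 : (n : ℝ) ≤ q (n + 1) := by exact_mod_cast (Nat.le_succ n).trans (h.le_apply (n + 1))
  have h3 := h.abs_pos n
  have h4 : 0 ≤ q n * |q (n + 1) * α - p (n + 1)| := by positivity
  rw [div_lt_iff₀ hε] at hn
  by_contra! hc
  nlinarith [mul_le_mul h2 hc hε.le (by positivity)]

/-- The points `z - j * α` with `j ≥ N` are dense. -/
theorem exists_sub_mem_Ioo (h : IsConvergentSeq α q p) (N : ℕ) {a b : ℝ} (hab : a < b) :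
    ∃ j : ℕ, N ≤ j ∧ ∃ z : ℤ, (z : ℝ) - j * α ∈ Ioo a b := by
  -- Multiples of q_k advance modulo 1 by steps shorter than the interval, so they cannot jump over
  -- it; the integer m makes the walk start far enough away that at least N steps are needed.
  obtain ⟨k, hk⟩ := h.exists_abs_lt (sub_pos.2 hab)
  have hq := h.pos k
  have hd := h.abs_pos k
  set d := |q k * α - p k| with hd'
  have key : ∀ x : ℝ, N * d ≤ x → ∃ i : ℕ, N ≤ i ∧ x < i * d ∧ i * d ≤ x + d := by
    intro x hx
    have hx0 : 0 ≤ x / d := div_nonneg ((by positivity : 0 ≤ N * d).trans hx) hd.le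
    refine ⟨⌊x / d⌋₊ + 1, ?_, ?_, ?_⟩
    · have : N ≤ ⌊x / d⌋₊ := Nat.le_floor ((le_div_iff₀ hd).2 hx)
      omega
    · have := Nat.lt_floor_add_one (x / d)
      rw [div_lt_iff₀ hd] at this
      exact_mod_cast this
    · have := Nat.floor_le hx0
      rw [le_div_iff₀ hd] at this
      push_cast
      linarith
  rcases abs_cases (q k * α - p k) with ⟨he, -⟩ | ⟨he, -⟩
  · obtain ⟨m, hm⟩ := exists_int_gt (b + N * d)
    obtain ⟨i, hi, h1, h2⟩ := key (m - b) (by linarith)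
    refine ⟨i * q k, by nlinarith, m + i * p k, ?_⟩
    have e : (((m + i * p k : ℤ) : ℝ) - (i * q k : ℕ) * α) = m - i * d := by
      rw [hd', he]; push_cast; ring
    rw [e]
    constructor <;> linarith
  · obtain ⟨m, hm⟩ := exists_int_lt (a - N * d)
    obtain ⟨i, hi, h1, h2⟩ := key (a - m) (by linarith)
    refine ⟨i * q k, by nlinarith, m + i * p k, ?_⟩
    have e : (((m + i * p k : ℤ) : ℝ) - (i * q k : ℕ) * α) = m + i * d := by
      rw [hd', he]; push_cast; ring
    rw [e]
    constructor <;> linarith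

/-- The first `q k + q (k + 1)` points `z - j * α` meet every half-open interval of length
`|q k * α - p k|`. -/
theorem exists_sub_mem_Ioc (h : IsConvergentSeq α q p) (k : ℕ) (s : ℝ) :
    ∃ j : ℕ, j < q (k + 1) + q k ∧ ∃ z : ℤ, (z : ℝ) - j * α ∈ Ioc s (s + |q k * α - p k|) := by
  classical
  have hex : ∃ j : ℕ, ∃ z : ℤ, (z : ℝ) - j * α ∈ Ioc s (s + |q k * α - p k|) := by
    obtain ⟨j, -, z, hz⟩ := h.exists_sub_mem_Ioo 0 (lt_add_of_pos_right s (h.abs_pos k))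
    exact ⟨j, z, hz.1, hz.2.le⟩
  refine ⟨Nat.find hex, ?_, Nat.find_spec hex⟩
  by_contra! hc
  obtain ⟨z, hz⟩ := Nat.find_spec hex
  have hmin := fun m (hm : m < Nat.find hex) => Nat.find_min hex hm
  generalize Nat.find hex = j at *
  have h0 := h.pos k
  have h1 := h.pos (k + 1)
  have hs := h.sign k
  have hlt := h.abs_lt k
  have hp1 := h.abs_pos (k + 1)
  -- From a minimal j ≥ q_{k+1} + q_k, going back q_{k+1} steps adds δ_{k+1}. If that leaves the
  -- interval, adding δ_k as well, of opposite sign and larger size, leads back in. Either way j was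
  -- not minimal.
  have m1 := hmin (j - q (k + 1)) (by omega)
  have m2 := hmin (j - (q (k + 1) + q k)) (by omega)
  push Not at m1 m2
  have n1 := m1 (z - p (k + 1))
  have n2 := m2 (z - (p (k + 1) + p k))
  rw [Nat.cast_sub (by omega)] at n1 n2
  push_cast at n1 n2
  apply n1
  have e1 : (z : ℝ) - p (k + 1) - (j - q (k + 1)) * α =
    (z - j * α) + (q (k + 1) * α - p (k + 1)) := by ring
  have e2 : (z : ℝ) - (p (k + 1) + p k) - (j - (q (k + 1) + q k)) * α =
    (z - j * α) + (q (k + 1) * α - p (k + 1)) + (q k * α - p k) := by ring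
  rw [e1]
  rw [e2] at n2
  generalize (z : ℝ) - j * α = y at *
  generalize (q (k + 1) : ℝ) * α - p (k + 1) = u at *
  generalize (q k : ℝ) * α - p k = v at *
  by_contra hn
  apply n2
  simp only [mem_Ioc, not_and_or, not_lt, not_le] at *
  rcases mul_neg_iff.1 hs with ⟨a, b⟩ | ⟨a, b⟩
  · rw [abs_of_pos a, abs_of_neg b] at *
    rcases hn with hn | hn <;> constructor <;> linarith
  · rw [abs_of_neg a, abs_of_pos b] at *
    rcases hn with hn | hn <;> constructor <;> linarith

end IsConvergentSeq

/-! ### Codings and cells -/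

/-- The Sturmian coding of the orbit of `t` under the rotation by `α`. -/
noncomputable def sturmianCode (α t : ℝ) (j : ℕ) : Fin 2 :=
  if Int.fract (t + j * α) < 1 - α then 0 else 1

/-- `s` and `t` lie in the same interval of the partition generated by the first `n` steps of the
rotation. -/
def SameCell (α : ℝ) (n : ℕ) (t s : ℝ) : Prop :=
  ∀ j : ℕ, j ≤ n → ⌊s + j * α⌋ = ⌊t + j * α⌋

theorem circleRotation_iterate (α : ℝ) {t : ℝ} (ht : t ∈ Ico (0 : ℝ) 1) (k : ℕ) :
    (circleRotation α)^[k] t = Int.fract (t + k * α) := by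
  induction k with
  | zero => simpa using (Int.fract_eq_self.2 ht).symm
  | succ k ih =>
    rw [Function.iterate_succ_apply', ih, circleRotation]
    have : Int.fract (t + k * α) + α = t + ((k + 1 : ℕ) : ℝ) * α - ⌊t + k * α⌋ := by
      rw [Int.fract]; push_cast; ring
    rw [this, Int.fract_sub_intCast]

theorem fract_mem_letterInterval (α u : ℝ) (i : Fin 2) :
    Int.fract u ∈ letterInterval α i ↔ (if Int.fract u < 1 - α then 0 else 1 : Fin 2) = i := by
  have h0 := Int.fract_nonneg u
  have h1 := Int.fract_lt_one u
  unfold letterInterval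
  fin_cases i <;> by_cases h : Int.fract u < 1 - α <;> simp [h, h0, h1] <;> linarith

theorem mem_wordInterval_iff {α t : ℝ} {n : ℕ} {u : Fin n → Fin 2} :
    t ∈ wordInterval α u ↔ t ∈ Ico (0 : ℝ) 1 ∧ ∀ k : Fin n, sturmianCode α t k = u k := by
  refine and_congr_right fun ht => forall_congr' fun k => ?_
  rw [circleRotation_iterate α ht, fract_mem_letterInterval]
  rfl

theorem sturmianCode_add_intCast (α t : ℝ) (z : ℤ) :
    sturmianCode α (t + z) = sturmianCode α t := by
  funext j
  unfold sturmianCode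
  rw [show t + z + j * α = t + j * α + z by ring, Int.fract_add_intCast]

theorem sturmianCode_fract (α t : ℝ) : sturmianCode α (Int.fract t) = sturmianCode α t := by
  rw [← sturmianCode_add_intCast α (Int.fract t) ⌊t⌋, Int.fract_add_floor]

theorem sturmianCode_mem (α t : ℝ) : sturmianCode α t ∈ sturmianShift α := by
  intro n
  refine ⟨Int.fract t, mem_wordInterval_iff.2 ⟨⟨Int.fract_nonneg t, Int.fract_lt_one t⟩, ?_⟩⟩
  intro k
  rw [sturmianCode_fract]
  rfl

theorem shiftMap_sturmianCode (α t : ℝ) :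
    shiftMap (sturmianCode α t) = sturmianCode α (t + α) := by
  funext j
  simp only [shiftMap, sturmianCode]
  rw [show t + ((j + 1 : ℕ) : ℝ) * α = t + α + j * α by push_cast; ring]

theorem shiftMap_iterate_apply {A : Type*} (x : ℕ → A) (k j : ℕ) :
    shiftMap^[k] x j = x (j + k) := by
  induction k generalizing x with
  | zero => rfl
  | succ k ih =>
    rw [Function.iterate_succ_apply, ih]
    rfl

theorem shiftMap_iterate_sturmianCode (α t : ℝ) (k : ℕ) :
    shiftMap^[k] (sturmianCode α t) = sturmianCode α (t + k * α) := by
  funext j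
  rw [shiftMap_iterate_apply]
  simp only [sturmianCode]
  rw [show t + ((j + k : ℕ) : ℝ) * α = t + k * α + j * α by push_cast; ring]

theorem sturmianCode_val {α : ℝ} (hα0 : 0 < α) (hα1 : α < 1) (t : ℝ) (j : ℕ) :
    ((sturmianCode α t j : ℕ) : ℤ) = ⌊t + ((j + 1 : ℕ) : ℝ) * α⌋ - ⌊t + j * α⌋ := by
  have h0 := Int.fract_nonneg (t + j * α)
  have h1 := Int.fract_lt_one (t + j * α)
  have e : t + ((j + 1 : ℕ) : ℝ) * α = (Int.fract (t + j * α) + α) + ⌊t + j * α⌋ := by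
    rw [Int.fract]; push_cast; ring
  rw [e, Int.floor_add_intCast, add_sub_cancel_right, eq_comm, Int.floor_eq_iff]
  unfold sturmianCode
  split_ifs with h
  · constructor <;> norm_num <;> linarith
  · constructor <;> norm_num <;> linarith

theorem sum_sturmianCode {α : ℝ} (hα0 : 0 < α) (hα1 : α < 1) (t : ℝ) (n : ℕ) :
    ∑ j ∈ Finset.range n, ((sturmianCode α t j : ℕ) : ℤ) = ⌊t + n * α⌋ - ⌊t⌋ := by
  rw [Finset.sum_congr rfl fun j _ => sturmianCode_val hα0 hα1 t j,
    Finset.sum_range_sub (fun j : ℕ => ⌊t + j * α⌋)]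
  simp

/-- The letters are the increments of the floors, so n letters together with the initial floor
determine n + 1 floors, and conversely. -/
theorem sameCell_iff {α : ℝ} (hα0 : 0 < α) (hα1 : α < 1) {n : ℕ} {t s : ℝ} :
    SameCell α n t s ↔ ⌊s⌋ = ⌊t⌋ ∧ ∀ j < n, sturmianCode α s j = sturmianCode α t j := by
  constructor
  · intro h
    refine ⟨by simpa using h 0 (Nat.zero_le _), fun j hj => ?_⟩
    have h1 := sturmianCode_val hα0 hα1 s j
    rw [h j hj.le, h (j + 1) hj, ← sturmianCode_val hα0 hα1 t j] at h1
    exact Fin.ext (by exact_mod_cast h1)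
  · rintro ⟨h0, h⟩ j hj
    have h1 := sum_sturmianCode hα0 hα1 s j
    rw [Finset.sum_congr rfl fun i hi => by
      rw [h i ((Finset.mem_range.1 hi).trans_le hj)], sum_sturmianCode hα0 hα1 t j] at h1
    omega

/-- Turns the return time of a cylinder into that of a cell under the rotation. -/
theorem return_nonempty_iff {α : ℝ} (hα0 : 0 < α) (hα1 : α < 1) {t : ℝ}
    (ht : t ∈ Ico (0 : ℝ) 1) (n k : ℕ) :
    (shiftMap^[k] '' shiftCylinder (sturmianShift α) (seqPrefix (sturmianCode α t) n) ∩
      shiftCylinder (sturmianShift α) (seqPrefix (sturmianCode α t) n)).Nonempty ↔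
    ∃ (s : ℝ) (z : ℤ), SameCell α n t s ∧ SameCell α n t (s + (k * α - z)) := by
  have ht0 : ⌊t⌋ = 0 := Int.floor_eq_zero_iff.2 ht
  constructor
  · rintro ⟨_, ⟨y, ⟨hyS, hy⟩, rfl⟩, ⟨-, hy'⟩⟩
    -- The sequence y need not itself be a coding, but only its first n + k letters matter, and
    -- these are coded by some s.
    obtain ⟨s, hs⟩ := hyS (n + k)
    obtain ⟨hs01, hs⟩ := mem_wordInterval_iff.1 hs
    have hs' : ∀ j < n + k, sturmianCode α s j = y j := fun j hj => hs ⟨j, hj⟩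
    refine ⟨s, ⌊s + k * α⌋, (sameCell_iff hα0 hα1).2 ⟨?_, fun j hj => ?_⟩,
      (sameCell_iff hα0 hα1).2 ⟨?_, fun j hj => ?_⟩⟩
    · rw [ht0, Int.floor_eq_zero_iff.2 hs01]
    · rw [hs' j (by omega)]
      exact hy ⟨j, hj⟩
    · rw [ht0, ← add_sub_assoc, Int.floor_sub_intCast, sub_self]
    · have e : s + (k * α - ⌊s + k * α⌋) = s + k * α + ((-⌊s + k * α⌋ : ℤ) : ℝ) := by
        push_cast; ring
      rw [e, sturmianCode_add_intCast, ← shiftMap_iterate_sturmianCode, shiftMap_iterate_apply,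
        hs' _ (by omega), ← shiftMap_iterate_apply y]
      exact hy' ⟨j, hj⟩
  · rintro ⟨s, z, h1, h2⟩
    refine ⟨_, ⟨sturmianCode α s, ⟨sturmianCode_mem α s, fun j => ?_⟩, rfl⟩, ?_⟩
    · exact ((sameCell_iff hα0 hα1).1 h1).2 j j.2
    · rw [shiftMap_iterate_sturmianCode]
      refine ⟨sturmianCode_mem α _, fun j => ?_⟩
      have e : s + (k * α - z) = s + k * α + ((-z : ℤ) : ℝ) := by
        push_cast; ring
      have := ((sameCell_iff hα0 hα1).1 h2).2 j j.2
      rw [e, sturmianCode_add_intCast] at this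
      exact this

theorem sameCell_self (α : ℝ) (n : ℕ) (t : ℝ) : SameCell α n t t := fun _ _ => rfl

/-- A cell is a half-open interval whose end points are of the form `z - j * α` with `j ≤ n`. -/
theorem exists_sameCell_iff_mem_Ico (α : ℝ) (n : ℕ) (t : ℝ) :
    ∃ (i j : ℕ) (y z : ℤ), i ≤ n ∧ j ≤ n ∧
      ∀ s, SameCell α n t s ↔ s ∈ Ico (y - i * α) (z - j * α) := by
  induction n with
  | zero =>
    refine ⟨0, 0, ⌊t⌋, ⌊t⌋ + 1, le_rfl, le_rfl, fun s => ?_⟩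
    simp [SameCell, Int.floor_eq_iff]
  | succ n ih =>
    obtain ⟨i, j, y, z, hi, hj, h⟩ := ih
    have hs : ∀ s, SameCell α (n + 1) t s ↔
        SameCell α n t s ∧ s ∈ Ico (⌊t + (n + 1 : ℕ) * α⌋ - (n + 1 : ℕ) * α)
          ((⌊t + (n + 1 : ℕ) * α⌋ + 1 : ℤ) - (n + 1 : ℕ) * α) := by
      intro s
      have : s ∈ Ico (⌊t + (n + 1 : ℕ) * α⌋ - (n + 1 : ℕ) * α)
          ((⌊t + (n + 1 : ℕ) * α⌋ + 1 : ℤ) - (n + 1 : ℕ) * α) ↔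
          ⌊s + (n + 1 : ℕ) * α⌋ = ⌊t + (n + 1 : ℕ) * α⌋ := by
        rw [Int.floor_eq_iff, mem_Ico, sub_le_iff_le_add, lt_sub_iff_add_lt]
        push_cast
        rfl
      rw [this]
      constructor
      · exact fun hc => ⟨fun j hj => hc j (by omega), hc _ le_rfl⟩
      · rintro ⟨h1, h2⟩ j hj
        rcases Nat.le_succ_iff.1 hj with hj | rfl
        · exact h1 j hj
        · exact h2
    have hI : ∃ (i' : ℕ) (y' : ℤ), i' ≤ n + 1 ∧ max ((y : ℝ) - i * α)
        (⌊t + (n + 1 : ℕ) * α⌋ - (n + 1 : ℕ) * α) = y' - i' * α := by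
      rcases max_choice ((y : ℝ) - i * α) (⌊t + (n + 1 : ℕ) * α⌋ - (n + 1 : ℕ) * α) with e | e
      · exact ⟨i, y, by omega, e⟩
      · exact ⟨n + 1, _, le_rfl, e⟩
    have hJ : ∃ (j' : ℕ) (z' : ℤ), j' ≤ n + 1 ∧ min ((z : ℝ) - j * α)
        ((⌊t + (n + 1 : ℕ) * α⌋ + 1 : ℤ) - (n + 1 : ℕ) * α) = z' - j' * α := by
      rcases min_choice ((z : ℝ) - j * α)
        ((⌊t + (n + 1 : ℕ) * α⌋ + 1 : ℤ) - (n + 1 : ℕ) * α) with e | e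
      · exact ⟨j, z, by omega, e⟩
      · exact ⟨n + 1, _, le_rfl, e⟩
    obtain ⟨i', y', hi', ei⟩ := hI
    obtain ⟨j', z', hj', ej⟩ := hJ
    refine ⟨i', j', y', z', hi', hj', fun s => ?_⟩
    rw [hs, h, ← ei, ← ej, ← mem_inter_iff, Ico_inter_Ico]

/-- If the integer points `z - j * α`, `j ≤ n`, avoid an open interval containing `t`, then the
interval is contained in the cell of `t`. -/
theorem sameCell_of_forall_notMem {α : ℝ} {n : ℕ} {t a b : ℝ} (ht : t ∈ Ioo a b)
    (h : ∀ j : ℕ, j ≤ n → ∀ z : ℤ, (z : ℝ) - j * α ∉ Ioo a b) {s : ℝ} (hs : s ∈ Ioo a b) :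
    SameCell α n t s := by
  have key : ∀ u ∈ Ioo a b, ∀ v ∈ Ioo a b, ∀ j : ℕ, j ≤ n → ⌊u + j * α⌋ ≤ ⌊v + j * α⌋ := by
    intro u hu v hv j hj
    by_contra! hc
    have h1 := Int.floor_le (u + j * α)
    have h2 := Int.floor_lt.1 hc
    exact h j hj ⌊u + j * α⌋ ⟨by linarith [hv.1], by linarith [hu.2]⟩
  exact fun j hj => le_antisymm (key s hs t ht j hj) (key t ht s hs j hj)

/-! ### Return times of cells -/

/-- The return time of the cylinder of length `n` around the coding of `t`. -/
noncomputable def codeReturnTime (α t : ℝ) (n : ℕ) : ℝ≥0∞ :=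
  returnTime shiftMap (shiftCylinder (sturmianShift α) (seqPrefix (sturmianCode α t) n))

theorem SameCell.add {α : ℝ} {n m K : ℕ} {t s : ℝ} (h : SameCell α n t s) (hm : m + K ≤ n) :
    SameCell α m (t + K * α) (s + K * α) := by
  intro j hj
  have := h (j + K) (by omega)
  push_cast at this
  rw [show s + K * α + j * α = s + (j + K) * α by ring, this]
  ring_nf

theorem codeReturnTime_le {α : ℝ} (hα0 : 0 < α) (hα1 : α < 1) {t : ℝ} (ht : t ∈ Ico (0 : ℝ) 1)
    {n k : ℕ} (hk : 0 < k) {z : ℤ} {s : ℝ} (h1 : SameCell α n t s)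
    (h2 : SameCell α n t (s + (k * α - z))) : codeReturnTime α t n ≤ k :=
  iInf₂_le k ⟨hk, (return_nonempty_iff hα0 hα1 ht n k).2 ⟨s, z, h1, h2⟩⟩

namespace IsConvergentSeq

variable {α : ℝ} {q : ℕ → ℕ} {p : ℕ → ℤ}

/-- By best approximation, no time before q_{k+1} moves a point by less than |δ_k|. -/
theorem le_codeReturnTime (h : IsConvergentSeq α q p) (hα0 : 0 < α) (hα1 : α < 1) {t : ℝ}
    (ht : t ∈ Ico (0 : ℝ) 1) {n k : ℕ}
    (hd : ∀ s s', SameCell α n t s → SameCell α n t s' → |s' - s| < |q k * α - p k|) :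
    q (k + 1) ≤ codeReturnTime α t n := by
  refine le_iInf₂ fun j hj => ?_
  obtain ⟨hj0, hj⟩ := hj
  obtain ⟨s, z, h1, h2⟩ := (return_nonempty_iff hα0 hα1 ht n j).1 hj
  have h3 := hd _ _ h1 h2
  rw [add_sub_cancel_left] at h3
  rw [Nat.cast_le]
  by_contra! hc
  have := h.le_abs k (j := j) (r := z) (by exact_mod_cast hj0) (by exact_mod_cast hc)
  rw [Int.cast_natCast] at this
  linarith

/-- The indices of the two end points differ by less than q_{k+1}, so best approximation bounds the
length of the cell below by |δ_k| > |δ_{k+1}|. Equal indices give an integer length. -/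
theorem codeReturnTime_le_of_lt (h : IsConvergentSeq α q p) (hα0 : 0 < α) (hα1 : α < 1) {t : ℝ}
    (ht : t ∈ Ico (0 : ℝ) 1) {n k : ℕ} (hn : n < q (k + 1)) :
    codeReturnTime α t n ≤ q (k + 1) := by
  obtain ⟨i, j, y, z, hi, hj, hI⟩ := exists_sameCell_iff_mem_Ico α n t
  have htI := (hI t).1 (sameCell_self α n t)
  have hpos : (0 : ℝ) < (z - j * α) - (y - i * α) := by linarith [htI.1, htI.2]
  have hle : |q k * α - p k| ≤ (z - j * α) - (y - i * α) := by
    rcases lt_trichotomy i j with hij | rfl | hij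
    · have := h.le_abs k (j := (j : ℤ) - i) (r := z - y) (by omega) (by omega)
      push_cast at this
      rwa [abs_sub_comm ((j - i : ℝ) * α),
        show ((z : ℝ) - y) - (j - i) * α = (z - j * α) - (y - i * α) by ring,
        abs_of_pos hpos] at this
    · have e : (z - i * α) - (y - i * α) = ((z - y : ℤ) : ℝ) := by push_cast; ring
      rw [e] at hpos ⊢
      have h1 : (1 : ℝ) ≤ ((z - y : ℤ) : ℝ) := by
        have : 0 < z - y := by exact_mod_cast hpos
        exact_mod_cast this
      have h2 := h.mul_add_mul k
      have h3 : (1 : ℝ) ≤ q (k + 1) := by exact_mod_cast h.pos (k + 1)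
      have h4 : 0 ≤ q k * |q (k + 1) * α - p (k + 1)| := by positivity
      nlinarith [h.abs_pos k]
    · have := h.le_abs k (j := (i : ℤ) - j) (r := y - z) (by omega) (by omega)
      push_cast at this
      rwa [show ((i : ℝ) - j) * α - (y - z) = (z - j * α) - (y - i * α) by ring,
        abs_of_pos hpos] at this
  have hlt := (h.abs_lt k).trans_le hle
  rcases le_or_gt 0 (q (k + 1) * α - p (k + 1)) with hs | hs
  · rw [abs_of_nonneg hs] at hlt
    refine codeReturnTime_le hα0 hα1 ht (h.pos _) (s := y - i * α) (z := p (k + 1))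
      ((hI _).2 ⟨le_rfl, by linarith⟩) ((hI _).2 ⟨by linarith, by linarith⟩)
  · rw [abs_of_neg hs] at hlt
    refine codeReturnTime_le hα0 hα1 ht (h.pos _)
      (s := y - i * α - (q (k + 1) * α - p (k + 1))) (z := p (k + 1))
      ((hI _).2 ⟨by linarith, by linarith⟩) ((hI _).2 ⟨by linarith, by linarith⟩)

/-- Two points of the cell at distance |δ_k| or more would be separated by one of the first q_k +
q_{k+1} cut points. -/
theorem le_codeReturnTime_of_le (h : IsConvergentSeq α q p) (hα0 : 0 < α) (hα1 : α < 1) {t : ℝ}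
    (ht : t ∈ Ico (0 : ℝ) 1) {n k : ℕ} (hn : q (k + 1) + q k ≤ n + 1) :
    q (k + 1) ≤ codeReturnTime α t n := by
  have key : ∀ s s', SameCell α n t s → SameCell α n t s' → s' - s < |q k * α - p k| := by
    intro s s' h1 h2
    by_contra! hc
    obtain ⟨j, hj, z, hz⟩ := h.exists_sub_mem_Ioc k s
    have e : ⌊s' + j * α⌋ = ⌊s + j * α⌋ := (h2 j (by omega)).trans (h1 j (by omega)).symm
    have h3 : ⌊s + j * α⌋ < z := Int.floor_lt.2 (by linarith [hz.1])
    have h4 : z ≤ ⌊s' + j * α⌋ := Int.le_floor.2 (by linarith [hz.2])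
    omega
  refine h.le_codeReturnTime hα0 hα1 ht fun s s' h1 h2 => _root_.abs_lt.2 ⟨?_, key s s' h1 h2⟩
  linarith [key s' s h2 h1]

/-- Close to the cut points `- j * α`, `j ≤ m`, on the side of `- (j + q k) * α`, the cells of
order `q k + m` are short. -/
theorem abs_sub_lt_of_sameCell (h : IsConvergentSeq α q p) {k m j : ℕ} {t : ℝ} {z : ℤ}
    (hj : j ≤ m) (ht : |t + j * α - z + (q k * α - p k) / 2| ≤ |q k * α - p k| / 4) {s s' : ℝ}
    (h1 : SameCell α (q k + m) t s) (h2 : SameCell α (q k + m) t s') :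
    |s' - s| < |q k * α - p k| := by
  have hp := h.abs_pos k
  have f1 := h1 j (by omega)
  have f2 := h1 (q k + j) (by omega)
  have g1 := h2 j (by omega)
  have g2 := h2 (q k + j) (by omega)
  -- The cut points with indices j and q_k + j are |δ_k| apart, and t lies in the middle half
  -- between them.
  have e : ∀ x : ℝ, x + ((q k + j : ℕ) : ℝ) * α = x + j * α + (q k * α - p k) + (p k : ℤ) := by
    intro x; push_cast; ring
  rw [e, e, Int.floor_add_intCast, Int.floor_add_intCast, add_left_inj] at f2 g2
  rw [_root_.abs_le] at ht
  generalize (q k : ℝ) * α - p k = v at *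
  rcases abs_cases v with ⟨hv, h0⟩ | ⟨hv, h0⟩
  · have a1 : ⌊t + j * α⌋ < z := Int.floor_lt.2 (by linarith)
    have a2 : z ≤ ⌊t + j * α + v⌋ := Int.le_floor.2 (by linarith)
    have b1 := Int.floor_lt.1 (f1.trans_lt a1)
    have b2 := Int.floor_lt.1 (g1.trans_lt a1)
    have c1 := Int.le_floor.1 (a2.trans f2.ge)
    have c2 := Int.le_floor.1 (a2.trans g2.ge)
    rw [hv, _root_.abs_lt]
    constructor <;> linarith
  · have a1 : z ≤ ⌊t + j * α⌋ := Int.le_floor.2 (by linarith)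
    have a2 : ⌊t + j * α + v⌋ < z := Int.floor_lt.2 (by linarith)
    have b1 := Int.le_floor.1 (a1.trans f1.ge)
    have b2 := Int.le_floor.1 (a1.trans g1.ge)
    have c1 := Int.floor_lt.1 (f2.trans_lt a2)
    have c2 := Int.floor_lt.1 (g2.trans_lt a2)
    rw [hv, _root_.abs_lt]
    constructor <;> linarith

/-- Close to the cut points `- j * α`, `n < j`, the cells of order `n` are long. -/
theorem exists_sameCell_add (h : IsConvergentSeq α q p) {k n j : ℕ} {t : ℝ} {z : ℤ}
    (hnj : n < j) (hj : j < q (k + 1) + q (k + 2))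
    (ht : |t + j * α - z - (q (k + 1) * α - p (k + 1)) / 2| ≤
      |q (k + 1) * α - p (k + 1)| / 4) :
    ∃ s, SameCell α n t s ∧ SameCell α n t (s + (q (k + 1) * α - p (k + 1))) := by
  -- The interval from z - jα + δ_{k+2} to z - jα + δ_{k+1} surrounds the cut point z - jα. An
  -- earlier cut point in it would be too close to z - jα if j - i < q_{k+2}, and otherwise too
  -- close to the end point z - jα + δ_{k+2}, by `gap`.
  have hcut : ∀ i : ℕ, i ≤ n → ∀ y : ℤ, (y : ℝ) - i * α ∉
      Ioo (z - j * α + min (q (k + 1) * α - p (k + 1)) (q (k + 2) * α - p (k + 2)))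
        (z - j * α + max (q (k + 1) * α - p (k + 1)) (q (k + 2) * α - p (k + 2))) := by
    intro i hi y hy
    obtain ⟨hy1, hy2⟩ := hy
    have hs := h.sign (k + 1)
    have hg := h.gap k
    have hlt := h.abs_lt (k + 1)
    simp only [add_assoc, Nat.reduceAdd] at hs hlt
    have hJ0 : (0 : ℤ) < j - i := by omega
    have b1 : |((j - i : ℤ) : ℝ) * α - (z - y : ℤ)| < |q (k + 1) * α - p (k + 1)| := by
      have e : ((j - i : ℤ) : ℝ) * α - (z - y : ℤ) = (y - i * α) - (z - j * α) := by
        push_cast; ring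
      rw [e]
      generalize (q (k + 1) : ℝ) * α - p (k + 1) = v at *
      generalize (q (k + 2) : ℝ) * α - p (k + 2) = u at *
      rcases mul_neg_iff.1 hs with ⟨a, b⟩ | ⟨a, b⟩
      · rw [abs_of_pos a, abs_of_neg b, _root_.abs_lt] at *
        rw [min_eq_right (b.trans a).le] at hy1
        rw [max_eq_left (b.trans a).le] at hy2
        constructor <;> linarith
      · rw [abs_of_neg a, abs_of_pos b, _root_.abs_lt] at *
        rw [min_eq_left (a.trans b).le] at hy1
        rw [max_eq_right (a.trans b).le] at hy2
        constructor <;> linarith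
    have b2 : 0 < |((j - i - q (k + 2) : ℤ) : ℝ) * α - (z - y - p (k + 2) : ℤ)| ∧
        |((j - i - q (k + 2) : ℤ) : ℝ) * α - (z - y - p (k + 2) : ℤ)| < |q k * α - p k| := by
      have e : ((j - i - q (k + 2) : ℤ) : ℝ) * α - (z - y - p (k + 2) : ℤ) =
          (y - i * α) - (z - j * α) - (q (k + 2) * α - p (k + 2)) := by
        push_cast; ring
      rw [e, _root_.abs_pos]
      generalize (q (k + 1) : ℝ) * α - p (k + 1) = v at *
      generalize (q (k + 2) : ℝ) * α - p (k + 2) = u at *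
      rcases mul_neg_iff.1 hs with ⟨a, b⟩ | ⟨a, b⟩
      · rw [abs_of_pos a, abs_of_neg b] at *
        rw [min_eq_right (b.trans a).le] at hy1
        rw [max_eq_left (b.trans a).le] at hy2
        refine ⟨by linarith, ?_⟩
        rw [_root_.abs_lt]
        constructor <;> linarith
      · rw [abs_of_neg a, abs_of_pos b] at *
        rw [min_eq_left (a.trans b).le] at hy1
        rw [max_eq_right (a.trans b).le] at hy2
        refine ⟨by linarith, ?_⟩
        rw [_root_.abs_lt]
        constructor <;> linarith
    rcases lt_trichotomy ((j : ℤ) - i) (q (k + 2)) with hc | hc | hc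
    · linarith [h.le_abs (k + 1) (r := z - y) hJ0 hc]
    · have h1 : |q k * α - p k| ≤ 1 := by
        have h2 := h.mul_add_mul k
        have h3 : (1 : ℝ) ≤ q (k + 1) := by exact_mod_cast h.pos (k + 1)
        have h4 : 0 ≤ q k * |q (k + 1) * α - p (k + 1)| := by positivity
        nlinarith [h.abs_pos k]
      rw [hc, sub_self, Int.cast_zero, zero_mul, zero_sub, abs_neg, ← Int.cast_abs] at b2
      have h2 : 0 < |z - y - p (k + 2)| := by exact_mod_cast b2.1
      have h3 : |z - y - p (k + 2)| < 1 := by exact_mod_cast b2.2.trans_le h1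
      omega
    · linarith [h.le_abs k (j := j - i - q (k + 2)) (r := z - y - p (k + 2)) (by omega) (by omega)]
  have hs := h.sign (k + 1)
  simp only [add_assoc, Nat.reduceAdd] at hs
  rw [_root_.abs_le] at ht
  -- The offset δ_{k+2} / 2 keeps the point and its translate by δ_{k+1} strictly inside, the two
  -- errors having opposite signs.
  refine ⟨z - j * α + (q (k + 2) * α - p (k + 2)) / 2,
    sameCell_of_forall_notMem ?_ hcut ?_, sameCell_of_forall_notMem ?_ hcut ?_⟩
  all_goals
    clear hcut
    generalize (q (k + 1) : ℝ) * α - p (k + 1) = v at *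
    generalize (q (k + 2) : ℝ) * α - p (k + 2) = u at *
    rcases mul_neg_iff.1 hs with ⟨a, b⟩ | ⟨a, b⟩
    · rw [min_eq_right (b.trans a).le, max_eq_left (b.trans a).le]
      rw [abs_of_pos a] at ht
      constructor <;> linarith
    · rw [min_eq_left (a.trans b).le, max_eq_right (a.trans b).le]
      rw [abs_of_neg a] at ht
      constructor <;> linarith

end IsConvergentSeq

/-! ### Almost every orbit is favourably placed infinitely often -/

/-- Almost every orbit of an ergodic map visits infinitely many of the sets of a sequence whose
measures do not tend to zero, up to a fixed delay. -/
theorem Ergodic.ae_exists_frequently_iterate_mem {X : Type*} [MeasurableSpace X] {μ : Measure X}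
    [IsProbabilityMeasure μ] {T : X → X} (hT : Ergodic T μ) {E : ℕ → Set X}
    (hE : ∀ i, MeasurableSet (E i)) {c : ℝ≥0∞} (hc : 0 < c) {P : ℕ → Prop}
    (h : ∃ᶠ i in atTop, P i) (hP : ∀ i, P i → c ≤ μ (E i)) :
    ∀ᵐ x ∂μ, ∃ K : ℕ, ∃ᶠ i in atTop, P i ∧ T^[K] x ∈ E i := by
  set F : ℕ → Set X := fun i => {x | P i ∧ x ∈ E i} with hF
  have hFm : ∀ i, MeasurableSet (F i) := fun i => (MeasurableSet.const (P i)).inter (hE i)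
  set L : Set X := limsup F atTop with hL
  have hLm : MeasurableSet L := MeasurableSet.measurableSet_limsup hFm
  have hmemL : ∀ x, x ∈ L ↔ ∃ᶠ i in atTop, P i ∧ x ∈ E i := fun x => by
    rw [hL, mem_limsup_iff_frequently_mem]; rfl
  have hLc : c ≤ μ L := by
    rw [hL, limsup_eq_iInf_iSup_of_nat]
    simp only [iInf_eq_iInter, iSup_eq_iUnion]
    have ht := tendsto_measure_iInter_atTop (μ := μ) (s := fun n : ℕ => ⋃ i, ⋃ (_ : i ≥ n), F i)
      (fun n => (MeasurableSet.iUnion fun i => MeasurableSet.iUnion fun _ =>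
        hFm i).nullMeasurableSet)
      (fun n m hnm => iUnion_mono fun i => iUnion_mono' fun hi => ⟨le_trans hnm hi, le_rfl⟩)
      ⟨0, measure_ne_top _ _⟩
    refine ge_of_tendsto' ht fun n => ?_
    obtain ⟨i, hi, hPi⟩ := (frequently_atTop.1 h) n
    refine (hP i hPi).trans (measure_mono ?_)
    intro x hx
    exact mem_iUnion₂.2 ⟨i, hi, hPi, hx⟩
  -- The limsup set L has measure at least c; its backward saturation satisfies T⁻¹ U ⊆ U, hence is
  -- null or conull.
  set U : Set X := ⋃ K : ℕ, T^[K] ⁻¹' L with hU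
  have hUm : MeasurableSet U := MeasurableSet.iUnion fun K => hT.measurable.iterate K hLm
  have hsub : T ⁻¹' U ⊆ U := by
    intro x hx
    obtain ⟨K, hK⟩ := mem_iUnion.1 hx
    exact mem_iUnion.2 ⟨K + 1, hK⟩
  have hLU : L ⊆ U := fun x hx => mem_iUnion.2 ⟨0, hx⟩
  have hae : ∀ᵐ x ∂μ, x ∈ U := by
    rcases hT.ae_empty_or_univ_of_preimage_ae_le hUm.nullMeasurableSet
      hsub.eventuallyLE with h0 | h1
    · exfalso
      have := hLc.trans (measure_mono hLU)
      rw [measure_congr h0, measure_empty] at this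
      exact absurd this (not_le.2 hc)
    · rw [eventuallyEq_univ] at h1
      exact h1
  filter_upwards [hae] with x hx
  obtain ⟨K, hK⟩ := mem_iUnion.1 hx
  exact ⟨K, (hmemL _).1 hK⟩

theorem ergodic_add_right_of_irrational {α : ℝ} (hirr : Irrational α) :
    Ergodic (fun y : UnitAddCircle => y + (α : UnitAddCircle)) := by
  rw [AddCircle.ergodic_add_right, addOrderOf_eq_zero_iff,
    AddCircle.not_isOfFinAddOrder_iff_forall_rat_ne_div]
  intro r hr
  exact hirr ⟨r, by simpa using hr⟩

/-- The points of the circle whose orbit under the rotation by `α` is in a ball at one of the times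
in `S`. -/
def nearOrbit (α c r : ℝ) (S : Finset ℕ) : Set UnitAddCircle :=
  ⋃ j ∈ S, (fun y : UnitAddCircle => y + ((j * α : ℝ) : UnitAddCircle)) ⁻¹'
    Metric.closedBall (c : UnitAddCircle) r

theorem measurableSet_nearOrbit (α c r : ℝ) (S : Finset ℕ) :
    MeasurableSet (nearOrbit α c r S) :=
  Finset.measurableSet_biUnion _ fun _ _ =>
    (measurable_id.add_const _) Metric.isClosed_closedBall.measurableSet

theorem coe_mem_nearOrbit {α c r t : ℝ} {S : Finset ℕ} (h : (t : UnitAddCircle) ∈ nearOrbit α c r S) :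
    ∃ j ∈ S, ∃ z : ℤ, |t + j * α - z - c| ≤ r := by
  obtain ⟨j, hj, hb⟩ := mem_iUnion₂.1 h
  refine ⟨j, hj, round (t + j * α - c), ?_⟩
  rw [mem_preimage, mem_closedBall_iff_norm, ← AddCircle.coe_add, ← AddCircle.coe_sub,
    UnitAddCircle.norm_eq] at hb
  rwa [show t + j * α - round (t + j * α - c) - c = t + j * α - c - round (t + j * α - c) by ring]

theorem IsConvergentSeq.volume_nearOrbit {α : ℝ} {q : ℕ → ℕ} {p : ℕ → ℤ}
    (h : IsConvergentSeq α q p) (k : ℕ) (c : ℝ) {S : Finset ℕ}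
    (hS : ∀ i ∈ S, ∀ j ∈ S, i < j → j < i + q (k + 1)) :
    volume (nearOrbit α c (|q k * α - p k| / 4) S) =
      ENNReal.ofReal (S.card * (|q k * α - p k| / 2)) := by
  have hp := h.abs_pos k
  have h1 : |q k * α - p k| ≤ 1 := by
    have h2 := h.mul_add_mul k
    have h3 : (1 : ℝ) ≤ q (k + 1) := by exact_mod_cast h.pos (k + 1)
    have h4 : 0 ≤ q k * |q (k + 1) * α - p (k + 1)| := by positivity
    nlinarith [h.abs_pos k]
  -- The centres are at least |δ_k| apart by best approximation, while the radii add up to |δ_k| /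
  -- 2.
  have hdis : ∀ i ∈ S, ∀ j ∈ S, i < j →
      Disjoint ((fun y : UnitAddCircle => y + ((i * α : ℝ) : UnitAddCircle)) ⁻¹'
        Metric.closedBall (c : UnitAddCircle) (|q k * α - p k| / 4))
        ((fun y : UnitAddCircle => y + ((j * α : ℝ) : UnitAddCircle)) ⁻¹'
        Metric.closedBall (c : UnitAddCircle) (|q k * α - p k| / 4)) := by
    intro i hi j hj hij
    rw [Set.disjoint_left]
    intro y hy1 hy2
    rw [mem_preimage, mem_closedBall_iff_norm] at hy1 hy2
    have e : (((j * α - i * α : ℝ)) : UnitAddCircle) =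
        (y + ((j * α : ℝ) : UnitAddCircle) - c) - (y + ((i * α : ℝ) : UnitAddCircle) - c) := by
      rw [AddCircle.coe_sub]; abel
    have h3 := norm_sub_le (y + ((j * α : ℝ) : UnitAddCircle) - c)
      (y + ((i * α : ℝ) : UnitAddCircle) - c)
    rw [← e, UnitAddCircle.norm_eq] at h3
    have h4 := h.le_abs k (j := (j : ℤ) - i) (r := round (j * α - i * α)) (by omega)
      (by have := hS i hi j hj hij; omega)
    push_cast at h4
    rw [show ((j : ℝ) - i) * α = j * α - i * α by ring] at h4
    linarith
  rw [nearOrbit, measure_biUnion_finset]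
  · simp_rw [measure_preimage_add_right, AddCircle.volume_closedBall]
    rw [Finset.sum_const, nsmul_eq_mul, ENNReal.ofReal_mul (Nat.cast_nonneg _),
      ENNReal.ofReal_natCast, min_eq_right (by linarith)]
    congr 2
    ring
  · intro i hi j hj hij
    rcases lt_or_gt_of_ne hij with hlt | hlt
    · exact hdis i hi j hj hlt
    · exact (hdis j hj i hi hlt).symm
  · exact fun j _ => (measurable_id.add_const _) Metric.isClosed_closedBall.measurableSet

instance UnitAddCircle.isProbabilityMeasure_volume :
    IsProbabilityMeasure (volume : Measure UnitAddCircle) :=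
  ⟨UnitAddCircle.measure_univ⟩

theorem add_const_iterate {G : Type*} [AddCommMonoid G] (a y : G) (K : ℕ) :
    (fun x => x + a)^[K] y = y + K • a := by
  induction K with
  | zero => simp
  | succ K ih => rw [Function.iterate_succ_apply', ih, succ_nsmul, add_assoc]

namespace IsConvergentSeq

variable {α : ℝ} {q : ℕ → ℕ} {p : ℕ → ℤ}

theorem tendsto_cast_atTop (h : IsConvergentSeq α q p) :
    Tendsto (fun k => (q k : ℝ)) atTop atTop :=
  tendsto_natCast_atTop_atTop.comp h.tendsto_atTop

theorem ae_frequently_le_codeReturnTime (h : IsConvergentSeq α q p) (hα0 : 0 < α) (hα1 : α < 1)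
    (hirr : Irrational α) {M : ℝ} (hM0 : 0 < M) (hM : ∀ k, (q (k + 1) : ℝ) ≤ M * q k) {c d : ℝ}
    (hc : 0 < c) (hcd : c < d) (hf : ∃ᶠ k in atTop, d * q k < q (k + 1)) :
    ∀ᵐ y : UnitAddCircle, ∀ t ∈ Ico (0 : ℝ) 1, (t : UnitAddCircle) = y →
      ∃ᶠ n : ℕ in atTop, ENNReal.ofReal (c * n) ≤ codeReturnTime α t n := by
  -- Half of the margin d - c pays for the εq_k extra letters, the other half for the delay K; ε ≤
  -- 1/2 keeps the times in the set less than q_{k+1} apart.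
  set ε := min ((d - c) / (2 * c)) (1 / 2) with hε
  have hε0 : 0 < ε := lt_min (div_pos (by linarith) (by linarith)) (by norm_num)
  have hε1 : ε ≤ 1 / 2 := min_le_right _ _
  have hε2 : c * ε ≤ (d - c) / 2 := by
    have : ε ≤ (d - c) / (2 * c) := min_le_left _ _
    rw [le_div_iff₀ (by linarith)] at this
    linarith
  set m : ℕ → ℕ := fun k => ⌊ε * q k⌋₊ with hm
  have hm1 : ∀ k, (m k : ℝ) ≤ ε * q k := fun k => Nat.floor_le (by positivity)
  have hm2 : ∀ k, ε * q k < m k + 1 := fun k => Nat.lt_floor_add_one _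
  have hvol : ∀ k, ENNReal.ofReal (ε / (2 * (M + 1))) ≤ volume
      (nearOrbit α (-((q k * α - p k) / 2)) (|q k * α - p k| / 4) (Finset.range (m k + 1))) := by
    intro k
    have hq0 : (0 : ℝ) < q k := by exact_mod_cast h.pos k
    rw [h.volume_nearOrbit k _ ?_]
    · apply ENNReal.ofReal_le_ofReal
      rw [Finset.card_range, div_le_iff₀ (by linarith)]
      have h1 := h.le_mul_abs hM k
      have h2 := hm2 k
      push_cast
      nlinarith [mul_le_mul_of_nonneg_right h2.le
        (mul_nonneg (h.abs_pos k).le (by linarith : 0 ≤ M + 1))]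
    · intro i _ j hj _
      have h1 : (m k : ℝ) < q k := by nlinarith [hm1 k]
      have h2 : m k < q k := by exact_mod_cast h1
      have h3 := h.mono k
      have h4 := h.pos k
      have := Finset.mem_range.1 hj
      omega
  have hae := (ergodic_add_right_of_irrational hirr).ae_exists_frequently_iterate_mem
    (fun k => measurableSet_nearOrbit α (-((q k * α - p k) / 2)) (|q k * α - p k| / 4)
      (Finset.range (m k + 1))) (c := ENNReal.ofReal (ε / (2 * (M + 1))))
    (ENNReal.ofReal_pos.2 (by positivity)) hf (fun k _ => hvol k)
  filter_upwards [hae] with y hy t ht hty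
  obtain ⟨K, hK⟩ := hy
  have htend : Tendsto (fun k => q k + m k + K) atTop atTop :=
    tendsto_atTop_mono (fun k => by omega) h.tendsto_atTop
  refine htend.frequently ?_
  have hlarge : ∀ᶠ k in atTop, c * K ≤ (d - c) / 2 * q k :=
    (h.tendsto_cast_atTop.const_mul_atTop (by linarith : 0 < (d - c) / 2)).eventually_ge_atTop _
  refine (hK.and_eventually hlarge).mono ?_
  rintro k ⟨⟨hk1, hk2⟩, hk3⟩
  rw [add_const_iterate, ← hty, ← AddCircle.coe_nsmul, ← AddCircle.coe_add, nsmul_eq_mul] at hk2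
  obtain ⟨j, hj, z, hz⟩ := coe_mem_nearOrbit hk2
  rw [sub_neg_eq_add] at hz
  have hle := h.le_codeReturnTime hα0 hα1 ht (n := q k + m k + K) (k := k) (by
    intro s s' h1 h2
    have := h.abs_sub_lt_of_sameCell (Nat.lt_succ_iff.1 (Finset.mem_range.1 hj)) hz
      (h1.add (m := q k + m k) (K := K) le_rfl) (h2.add (m := q k + m k) (K := K) le_rfl)
    rwa [add_sub_add_right_eq_sub] at this)
  refine le_trans ?_ hle
  rw [← ENNReal.ofReal_natCast (q (k + 1))]
  apply ENNReal.ofReal_le_ofReal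
  push_cast
  have hq0 : (0 : ℝ) < q k := by exact_mod_cast h.pos k
  nlinarith [mul_le_mul_of_nonneg_left (hm1 k) hc.le]

theorem ae_frequently_codeReturnTime_le (h : IsConvergentSeq α q p) (hα0 : 0 < α) (hα1 : α < 1)
    (hirr : Irrational α) {M : ℝ} (hM0 : 0 < M) (hM : ∀ k, (q (k + 1) : ℝ) ≤ M * q k) {c d : ℝ}
    (hd : 0 < d) (hcd : d < c) (hf : ∃ᶠ k in atTop, q k < d * ((q (k + 1) : ℝ) + q k - 1)) :
    ∀ᵐ y : UnitAddCircle, ∀ t ∈ Ico (0 : ℝ) 1, (t : UnitAddCircle) = y →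
      ∃ᶠ n : ℕ in atTop, codeReturnTime α t n ≤ ENNReal.ofReal (c * n) := by
  have hc : 0 < c := hd.trans hcd
  set ε := (c - d) / (2 * c) with hε
  have hε0 : 0 < ε := div_pos (by linarith) (by linarith)
  have hεc : c * ε = (c - d) / 2 := by rw [hε]; field_simp
  have hε1 : ε ≤ 1 / 2 := by nlinarith
  set m : ℕ → ℕ := fun k => ⌊ε * q (k + 1)⌋₊ with hm
  have hm1 : ∀ k, (m k : ℝ) ≤ ε * q (k + 1) := fun k => Nat.floor_le (by positivity)
  have hm2 : ∀ k, ε * q (k + 1) < m k + 1 := fun k => Nat.lt_floor_add_one _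
  have hmq : ∀ k, m k < q (k + 1) := fun k => by
    have h0 : (0 : ℝ) < q (k + 1) := by exact_mod_cast h.pos (k + 1)
    have h1 : (m k : ℝ) < q (k + 1) := by nlinarith [hm1 k]
    exact_mod_cast h1
  -- The times in (N, N + m] are the last m below q_{k+1} + q_{k+2}, so `exists_sameCell_add`
  -- applies to all of them with order N.
  set N : ℕ → ℕ := fun k => q (k + 1) + q (k + 2) - 1 - m k with hN
  set E : ℕ → Set UnitAddCircle := fun k => nearOrbit α ((q (k + 1) * α - p (k + 1)) / 2)
    (|q (k + 1) * α - p (k + 1)| / 4) (Finset.Ioc (N k) (N k + m k)) with hE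
  have hvol : ∀ k, 2 ≤ ε * q (k + 1) →
      ENNReal.ofReal (ε / 2 / (2 * (M + 1))) ≤ volume (E k) := by
    intro k hk
    have hq0 : (0 : ℝ) < q (k + 1) := by exact_mod_cast h.pos (k + 1)
    rw [hE, h.volume_nearOrbit (k + 1) _ ?_]
    · apply ENNReal.ofReal_le_ofReal
      rw [Nat.card_Ioc, add_tsub_cancel_left, div_le_iff₀ (by linarith)]
      have h1 := h.le_mul_abs hM (k + 1)
      have h2 : ε / 2 * q (k + 1) ≤ m k := by linarith [hm2 k]
      nlinarith [mul_le_mul_of_nonneg_right h2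
        (mul_nonneg (h.abs_pos (k + 1)).le (by linarith : 0 ≤ M + 1))]
    · intro i hi j hj _
      have h2 := hmq k
      have h3 : q (k + 1) ≤ q (k + 1 + 1) := h.mono (k + 1)
      rw [Finset.mem_Ioc] at hi hj
      omega
  have hf' : ∃ᶠ k in atTop, (q (k + 1) : ℝ) < d * ((q (k + 2) : ℝ) + q (k + 1) - 1) := by
    rw [← Filter.map_add_atTop_eq_nat 1] at hf
    exact frequently_map.1 hf
  have htq : Tendsto (fun k => (q (k + 1) : ℝ)) atTop atTop :=
    h.tendsto_cast_atTop.comp (tendsto_add_atTop_nat 1)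
  have hf2 := hf'.and_eventually ((htq.const_mul_atTop hε0).eventually_ge_atTop 2)
  -- The delay runs backwards here. A long cell is wanted, and the cell of t of order N - K contains
  -- the translate by Kα of the cell of t - Kα of order N.
  have hirr' : Irrational (-α) := hirr.neg
  have hae := (ergodic_add_right_of_irrational hirr').ae_exists_frequently_iterate_mem
    (E := E) (fun k => measurableSet_nearOrbit _ _ _ _)
    (c := ENNReal.ofReal (ε / 2 / (2 * (M + 1))))
    (ENNReal.ofReal_pos.2 (by positivity)) hf2 (fun k hk => hvol k hk.2)
  filter_upwards [hae] with y hy t ht hty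
  obtain ⟨K, hK⟩ := hy
  have hqN : ∀ k, q (k + 2) ≤ N k := fun k => by
    have := hmq k
    simp only [hN]
    omega
  have htend : Tendsto (fun k => N k - K) atTop atTop := by
    refine tendsto_atTop_mono (fun k => ?_) (tendsto_sub_atTop_nat K)
    have h1 := hqN k
    have h2 := h.le_apply (k + 2)
    omega
  refine htend.frequently ?_
  have hlarge : ∀ᶠ k in atTop, (K : ℝ) ≤ ε * q (k + 1) :=
    (htq.const_mul_atTop hε0).eventually_ge_atTop _
  refine (hK.and_eventually (hlarge.and (h.tendsto_atTop.eventually_ge_atTop K))).mono ?_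
  rintro k ⟨⟨⟨hk1, -⟩, hk2⟩, hk3, hk4⟩
  rw [add_const_iterate, ← hty, ← AddCircle.coe_nsmul, ← AddCircle.coe_add, nsmul_eq_mul] at hk2
  obtain ⟨j, hj, z, hz⟩ := coe_mem_nearOrbit hk2
  rw [Finset.mem_Ioc] at hj
  have hpos1 := h.pos (k + 1)
  have hmq' := hmq k
  have hKN : K ≤ N k := by
    have h1 := hqN k
    have h2 := h.monotone (show k ≤ k + 2 by omega)
    omega
  have hNe : N k + m k + 1 = q (k + 1) + q (k + 2) := by
    simp only [hN]
    omega
  obtain ⟨s, h1, h2⟩ := h.exists_sameCell_add hj.1 (by omega) hz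
  have hle := codeReturnTime_le hα0 hα1 ht (n := N k - K) (k := q (k + 1)) (z := p (k + 1))
    (s := s + K * α) hpos1 (by
      have := h1.add (m := N k - K) (K := K) (by omega)
      rwa [mul_neg, neg_add_cancel_right] at this) (by
      have := h2.add (m := N k - K) (K := K) (by omega)
      rwa [mul_neg, neg_add_cancel_right, add_right_comm] at this)
  refine hle.trans ?_
  rw [← ENNReal.ofReal_natCast (q (k + 1))]
  apply ENNReal.ofReal_le_ofReal
  rw [Nat.cast_sub hKN]
  have hNe' : (N k : ℝ) + m k + 1 = q (k + 1) + q (k + 2) := by exact_mod_cast hNe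
  have hq2 : (1 : ℝ) ≤ q (k + 2) := by exact_mod_cast h.pos (k + 2)
  have hq1 : (1 : ℝ) ≤ q (k + 1) := by exact_mod_cast hpos1
  have e : (N k : ℝ) = q (k + 2) + q (k + 1) - 1 - m k := by linarith
  rw [e]
  have h5 := mul_le_mul_of_nonneg_left (hm1 k) hc.le
  have h6 := mul_le_mul_of_nonneg_left hk3 hc.le
  have h7 : c * (ε * q (k + 1)) = (c - d) / 2 * q (k + 1) := by rw [← mul_assoc, hεc]
  rw [h7] at h5 h6
  nlinarith [mul_nonneg (sub_nonneg.2 hcd.le) (sub_nonneg.2 hq2)]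

end IsConvergentSeq

/-! ### Unique ergodicity of the rotation -/

/-- Unique ergodicity of the irrational rotation. -/
theorem eq_volume_of_map_add_eq {α : ℝ} (hirr : Irrational α) (m : Measure UnitAddCircle)
    [IsProbabilityMeasure m] (h : m.map (fun y => y + (α : UnitAddCircle)) = m) : m = volume := by
  have hn : ∀ n : ℕ, m.map (fun y => y + n • (α : UnitAddCircle)) = m := by
    intro n
    induction n with
    | zero => simp
    | succ n ih =>
      have : (fun y : UnitAddCircle => y + (n + 1) • (α : UnitAddCircle)) =
          (fun y => y + (α : UnitAddCircle)) ∘ fun y => y + n • (α : UnitAddCircle) := by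
        funext y
        simp only [Function.comp, succ_nsmul, add_assoc]
      rw [this, ← Measure.map_map (measurable_add_const _) (measurable_add_const _), ih, h]
  have hz : ∀ n : ℤ, m.map (fun y => y + n • (α : UnitAddCircle)) = m := by
    intro n
    obtain ⟨k, rfl | rfl⟩ := n.eq_nat_or_neg
    · simpa using hn k
    · conv_lhs => rw [← hn k]
      rw [Measure.map_map (measurable_add_const _) (measurable_add_const _)]
      have : (fun y : UnitAddCircle => y + (-(k : ℤ)) • (α : UnitAddCircle)) ∘
          (fun y => y + k • (α : UnitAddCircle)) = id := by
        funext y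
        simp
      rw [this, Measure.map_id]
  have hdense : DenseRange (· • (α : UnitAddCircle) : ℤ → UnitAddCircle) :=
    AddCircle.denseRange_zsmul_coe_iff.2 (by simpa using hirr)
  have hall : ∀ g : UnitAddCircle, m.map (fun y => y + g) = m := by
    intro g
    have hp : IsProbabilityMeasure (m.map (fun y => y + g)) :=
      Measure.isProbabilityMeasure_map (measurable_add_const g).aemeasurable
    refine ext_of_forall_integral_eq_of_IsFiniteMeasure fun f => ?_
    have hint : ∀ g : UnitAddCircle, ∫ x, f x ∂(m.map (fun y => y + g)) = ∫ x, f (x + g) ∂m :=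
      fun g => integral_map (measurable_add_const g).aemeasurable
        f.continuous.aestronglyMeasurable
    rw [hint]
    -- Invariance under the dense subgroup generated by α extends to all translations by continuity;
    -- uniqueness of Haar measure then applies.
    have hcont : Continuous fun g : UnitAddCircle => ∫ x, f (x + g) ∂m := by
      refine continuous_of_dominated (bound := fun _ => ‖f‖) ?_ ?_ (integrable_const _) ?_
      · exact fun g => (f.continuous.comp (continuous_add_const g)).aestronglyMeasurable
      · exact fun g => Eventually.of_forall fun x => f.norm_coe_le_norm _
      · exact Eventually.of_forall fun x => f.continuous.comp (continuous_const_add x)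
    have := hdense.equalizer hcont (continuous_const (y := ∫ x, f x ∂m)) (by
      funext n
      simp only [Function.comp]
      rw [← hint, hz])
    exact congrFun this g
  have hinv : m.IsAddLeftInvariant := ⟨fun g => by
    simp_rw [add_comm g]
    exact hall g⟩
  rw [Measure.isAddInvariant_eq_smul_of_compactSpace m volume]
  have hs := congrArg (fun μ : Measure UnitAddCircle => μ univ)
    (Measure.isAddInvariant_eq_smul_of_compactSpace m volume)
  simp only [measure_univ, Measure.smul_apply] at hs
  have : Measure.addHaarScalarFactor m (volume : Measure UnitAddCircle) = 1 := by
    rw [ENNReal.smul_def, smul_eq_mul, mul_one] at hs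
    exact_mod_cast hs.symm
  rw [this, one_smul]

/-! ### The coding map and the invariant measure -/

/-- The Sturmian coding as a function on the circle. -/
noncomputable def circleCode (α : ℝ) (y : UnitAddCircle) : ℕ → Fin 2 :=
  sturmianCode α (AddCircle.equivIco 1 0 y)

theorem circleCode_coe (α t : ℝ) : circleCode α (t : UnitAddCircle) = sturmianCode α t := by
  rw [circleCode, AddCircle.coe_equivIco_mk_apply, div_one, mul_one, sturmianCode_fract]

theorem measurable_sturmianCode (α : ℝ) : Measurable (sturmianCode α) := by
  refine measurable_pi_lambda _ fun j => ?_
  exact Measurable.ite (measurableSet_lt (measurable_id.add_const _).fract measurable_const)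
    measurable_const measurable_const

theorem measurable_circleCode (α : ℝ) : Measurable (circleCode α) :=
  (measurable_sturmianCode α).comp
    (measurable_subtype_coe.comp (AddCircle.measurableEquivIco 1 0).measurable)

theorem shiftMap_circleCode (α : ℝ) (y : UnitAddCircle) :
    shiftMap (circleCode α y) = circleCode α (y + (α : UnitAddCircle)) := by
  induction y using QuotientAddGroup.induction_on with
  | H t =>
    rw [← AddCircle.coe_add, circleCode_coe, circleCode_coe, shiftMap_sturmianCode]

theorem circleCode_mem (α : ℝ) (y : UnitAddCircle) : circleCode α y ∈ sturmianShift α :=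
  sturmianCode_mem α _

theorem measurable_shiftMap : Measurable (shiftMap : (ℕ → Fin 2) → ℕ → Fin 2) :=
  measurable_pi_lambda _ fun i => measurable_pi_apply (i + 1)

theorem measurableSet_sturmianShift (α : ℝ) : MeasurableSet (sturmianShift α) := by
  have : sturmianShift α = ⋂ n : ℕ, (fun x => seqPrefix x n) ⁻¹'
      {u : Fin n → Fin 2 | (wordInterval α u).Nonempty} := by
    ext x
    simp [sturmianShift]
  rw [this]
  refine MeasurableSet.iInter fun n => ?_
  exact (measurable_pi_lambda _ fun i => measurable_pi_apply _) (Set.toFinite _).measurableSet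

theorem isInvariantProbability_map_circleCode (α : ℝ) :
    IsInvariantProbability (sturmianShift α) ((volume : Measure UnitAddCircle).map
      (circleCode α)) where
  isProbability := Measure.isProbabilityMeasure_map (measurable_circleCode α).aemeasurable
  carried := by
    rw [Measure.map_apply (measurable_circleCode α) (measurableSet_sturmianShift α).compl]
    convert measure_empty (μ := (volume : Measure UnitAddCircle))
    ext y
    simp [circleCode_mem]
  invariant := by
    refine ⟨measurable_shiftMap, ?_⟩
    rw [Measure.map_map measurable_shiftMap (measurable_circleCode α)]
    have : shiftMap ∘ circleCode α = circleCode α ∘ fun y => y + (α : UnitAddCircle) :=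
      funext fun y => shiftMap_circleCode α y
    rw [this, ← Measure.map_map (measurable_circleCode α) (measurable_add_const _),
      (measurePreserving_add_right volume (α : UnitAddCircle)).map_eq]

/-! ### Recovering the point from its coding -/

/-- The sum of the first `n` letters. -/
def letterSum (x : ℕ → Fin 2) (n : ℕ) : ℤ := ∑ j ∈ Finset.range n, ((x j : ℕ) : ℤ)

/-- The point of the interval `[0, 1]` that is coded by `x`. -/
noncomputable def codedPoint (α : ℝ) (x : ℕ → Fin 2) : ℝ := ⨆ n : ℕ, ((letterSum x n : ℝ) - n * α)

theorem measurable_codedPoint (α : ℝ) : Measurable (codedPoint α) := by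
  refine Measurable.iSup fun n => Measurable.sub_const ?_ _
  have : Measurable fun x : ℕ → Fin 2 => letterSum x n :=
    Finset.measurable_sum _ fun j _ =>
      (measurable_of_countable fun a : Fin 2 => ((a : ℕ) : ℤ)).comp (measurable_pi_apply j)
  exact (measurable_of_countable fun z : ℤ => (z : ℝ)).comp this

/-- A point t coding a long enough prefix lies between the two sides. So the supremum in
`codedPoint` is finite and respects every upper constraint. -/
theorem letterSum_sub_le {α : ℝ} (hα0 : 0 < α) (hα1 : α < 1) {x : ℕ → Fin 2}
    (hx : x ∈ sturmianShift α) (i j : ℕ) :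
    (letterSum x i : ℝ) - i * α ≤ letterSum x j + 1 - j * α := by
  obtain ⟨t, ht⟩ := hx (max i j)
  obtain ⟨ht01, ht⟩ := mem_wordInterval_iff.1 ht
  have hs : ∀ n ≤ max i j, letterSum x n = ⌊t + n * α⌋ := by
    intro n hn
    have := sum_sturmianCode hα0 hα1 t n
    rw [Int.floor_eq_zero_iff.2 ht01, sub_zero] at this
    rw [← this, letterSum]
    refine Finset.sum_congr rfl fun l hl => ?_
    rw [ht ⟨l, (Finset.mem_range.1 hl).trans_le hn⟩]
    rfl
  rw [hs i (le_max_left _ _), hs j (le_max_right _ _)]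
  linarith [Int.floor_le (t + i * α), Int.lt_floor_add_one (t + j * α)]

theorem letterSum_le_codedPoint {α : ℝ} (hα0 : 0 < α) (hα1 : α < 1) {x : ℕ → Fin 2}
    (hx : x ∈ sturmianShift α) (n : ℕ) :
    (letterSum x n : ℝ) ≤ codedPoint α x + n * α ∧
      codedPoint α x + n * α ≤ letterSum x n + 1 := by
  constructor
  · have := le_ciSup (f := fun n : ℕ => ((letterSum x n : ℝ) - n * α))
      ⟨_, forall_mem_range.2 fun i => letterSum_sub_le hα0 hα1 hx i 0⟩ n
    rw [codedPoint]
    linarith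
  · have := ciSup_le (f := fun n : ℕ => ((letterSum x n : ℝ) - n * α))
      fun i => letterSum_sub_le hα0 hα1 hx i n
    rw [codedPoint]
    linarith

theorem shiftMap_mem_sturmianShift {α : ℝ} {x : ℕ → Fin 2} (hx : x ∈ sturmianShift α) :
    shiftMap x ∈ sturmianShift α := by
  intro n
  obtain ⟨t, ht⟩ := hx (n + 1)
  obtain ⟨ht01, ht⟩ := mem_wordInterval_iff.1 ht
  refine ⟨Int.fract (t + α), mem_wordInterval_iff.2 ⟨⟨Int.fract_nonneg _, Int.fract_lt_one _⟩,
    fun k => ?_⟩⟩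
  rw [sturmianCode_fract, ← shiftMap_sturmianCode]
  exact ht k.succ

theorem letterSum_shiftMap (x : ℕ → Fin 2) (n : ℕ) :
    letterSum (shiftMap x) n = letterSum x (n + 1) - (x 0 : ℕ) := by
  rw [letterSum, letterSum, Finset.sum_range_succ']
  simp [shiftMap]

namespace IsConvergentSeq

variable {α : ℝ} {q : ℕ → ℕ} {p : ℕ → ℤ}

/-- The constraints S_n ≤ t + nα ≤ S_n + 1, n ≥ 1, where S_n is the letter sum, have only one
solution: by density, some z - nα would separate two solutions and force S_n < z < S_n + 1. The
index 0 is dropped because the shifted sequence says nothing about it. -/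
theorem codedPoint_shiftMap (h : IsConvergentSeq α q p) (hα0 : 0 < α) (hα1 : α < 1)
    {x : ℕ → Fin 2} (hx : x ∈ sturmianShift α) :
    codedPoint α (shiftMap x) = codedPoint α x + α - (x 0 : ℕ) := by
  have h1 := letterSum_le_codedPoint hα0 hα1 hx
  have h2 := letterSum_le_codedPoint hα0 hα1 (shiftMap_mem_sturmianShift hx)
  have key : ∀ a b : ℝ, (∀ n : ℕ, 1 ≤ n → (letterSum x n : ℝ) ≤ a + n * α) →
      (∀ n : ℕ, 1 ≤ n → b + n * α ≤ letterSum x n + 1) → b ≤ a := by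
    intro a b ha hb
    by_contra! hlt
    obtain ⟨n, hn, z, hz⟩ := h.exists_sub_mem_Ioo 1 hlt
    have h3 := ha n hn
    have h4 := hb n hn
    have h5 : (letterSum x n : ℝ) < z := by linarith [hz.1]
    have h6 : (z : ℝ) < letterSum x n + 1 := by linarith [hz.2]
    have h5' : letterSum x n < z := by exact_mod_cast h5
    have h6' : z < letterSum x n + 1 := by exact_mod_cast h6
    omega
  have h3 : ∀ n : ℕ, 1 ≤ n →
      (letterSum x n : ℝ) ≤ (codedPoint α (shiftMap x) - α + (x 0 : ℕ)) + n * α ∧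
      (codedPoint α (shiftMap x) - α + (x 0 : ℕ)) + n * α ≤ letterSum x n + 1 := by
    intro n hn
    obtain ⟨n, rfl⟩ := Nat.exists_eq_add_of_le' hn
    obtain ⟨h3, h4⟩ := h2 n
    rw [letterSum_shiftMap] at h3 h4
    push_cast at h3 h4 ⊢
    constructor <;> linarith
  have e1 := key _ _ (fun n hn => (h3 n hn).1) (fun n _ => (h1 n).2)
  have e2 := key _ _ (fun n _ => (h1 n).1) (fun n hn => (h3 n hn).2)
  linarith

end IsConvergentSeq

/-- The letter sums are the floors of t + nα except when the upper constraint is an equality, which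
requires an integer t + nα. -/
theorem sturmianCode_codedPoint {α : ℝ} (hα0 : 0 < α) (hα1 : α < 1) {x : ℕ → Fin 2}
    (hx : x ∈ sturmianShift α) (hne : ∀ (n : ℕ) (z : ℤ), codedPoint α x + n * α ≠ z) :
    sturmianCode α (codedPoint α x) = x := by
  have hfl : ∀ n : ℕ, ⌊codedPoint α x + n * α⌋ = letterSum x n := by
    intro n
    obtain ⟨h1, h2⟩ := letterSum_le_codedPoint hα0 hα1 hx n
    refine Int.floor_eq_iff.2 ⟨h1, lt_of_le_of_ne h2 ?_⟩
    have := hne n (letterSum x n + 1)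
    push_cast at this
    exact this
  funext j
  have h1 := sturmianCode_val hα0 hα1 (codedPoint α x) j
  rw [hfl, hfl, letterSum, letterSum, Finset.sum_range_succ, add_sub_cancel_left] at h1
  exact Fin.ext (by exact_mod_cast h1)

/-- An invariant probability projects to the Lebesgue measure of the circle, and almost every
sequence is the coding of its projection. -/
theorem IsInvariantProbability.map_codedPoint {α : ℝ} {q : ℕ → ℕ} {p : ℕ → ℤ}
    (h : IsConvergentSeq α q p) (hα0 : 0 < α) (hα1 : α < 1) (hirr : Irrational α)
    {μ : Measure (ℕ → Fin 2)} (hμ : IsInvariantProbability (sturmianShift α) μ) :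
    μ.map (fun x => (codedPoint α x : UnitAddCircle)) = volume ∧
    ∀ᵐ x ∂μ, codedPoint α x ∈ Ico (0 : ℝ) 1 ∧ sturmianCode α (codedPoint α x) = x := by
  have := hμ.isProbability
  have hS : ∀ᵐ x ∂μ, x ∈ sturmianShift α := hμ.carried
  have hm : Measurable fun x => (codedPoint α x : UnitAddCircle) :=
    AddCircle.measurable_mk'.comp (measurable_codedPoint α)
  have hvol : μ.map (fun x => (codedPoint α x : UnitAddCircle)) = volume := by
    have := Measure.isProbabilityMeasure_map (μ := μ) hm.aemeasurable
    refine eq_volume_of_map_add_eq hirr _ ?_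
    rw [Measure.map_map (measurable_add_const _) hm]
    conv_rhs => rw [← hμ.invariant.map_eq, Measure.map_map hm measurable_shiftMap]
    refine Measure.map_congr ?_
    filter_upwards [hS] with x hx
    simp only [Function.comp]
    rw [h.codedPoint_shiftMap hα0 hα1 hx, AddCircle.coe_sub, AddCircle.coe_add,
      ← nsmul_one, AddCircle.coe_nsmul, AddCircle.coe_period, nsmul_zero, sub_zero]
  refine ⟨hvol, ?_⟩
  -- The exceptional points form one backward orbit of 0, countable and therefore null.
  have hcount : (range fun n : ℕ => ((-(n * α) : ℝ) : UnitAddCircle)).Countable :=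
    countable_range _
  have : NullSingletonClass (volume : Measure UnitAddCircle) := ⟨fun y => by
    rw [← Metric.closedBall_zero, AddCircle.volume_closedBall]
    simp⟩
  have hae : ∀ᵐ y : UnitAddCircle, y ∉ range fun n : ℕ => ((-(n * α) : ℝ) : UnitAddCircle) :=
    hcount.ae_notMem _
  rw [← hvol] at hae
  filter_upwards [hS, ae_of_ae_map hm.aemeasurable hae] with x hx hx'
  have hne : ∀ (n : ℕ) (z : ℤ), codedPoint α x + n * α ≠ z := by
    intro n z hz
    apply hx'
    refine ⟨n, ?_⟩
    rw [show codedPoint α x = z + -(n * α) by linarith, AddCircle.coe_add]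
    have : ((z : ℝ) : UnitAddCircle) = 0 := by
      rw [← zsmul_one, AddCircle.coe_zsmul, AddCircle.coe_period, zsmul_zero]
    rw [this, zero_add]
  obtain ⟨h1, h2⟩ := letterSum_le_codedPoint hα0 hα1 hx 0
  have h3 := hne 0 1
  simp [letterSum] at h1 h2 h3
  exact ⟨⟨h1, lt_of_le_of_ne h2 h3⟩, sturmianCode_codedPoint hα0 hα1 hx hne⟩

theorem IsInvariantProbability.eq_map_circleCode {α : ℝ} {q : ℕ → ℕ} {p : ℕ → ℤ}
    (h : IsConvergentSeq α q p) (hα0 : 0 < α) (hα1 : α < 1) (hirr : Irrational α)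
    {μ : Measure (ℕ → Fin 2)} (hμ : IsInvariantProbability (sturmianShift α) μ) :
    μ = (volume : Measure UnitAddCircle).map (circleCode α) := by
  obtain ⟨hvol, hae⟩ := hμ.map_codedPoint h hα0 hα1 hirr
  have hm : Measurable fun x => (codedPoint α x : UnitAddCircle) :=
    AddCircle.measurable_mk'.comp (measurable_codedPoint α)
  rw [← hvol, Measure.map_map (measurable_circleCode α) hm]
  conv_lhs => rw [← Measure.map_id (μ := μ)]
  refine Measure.map_congr ?_
  filter_upwards [hae] with x hx
  simp only [Function.comp, id]
  rw [circleCode_coe, hx.2]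

/-! ### From return times to return rates -/

theorem exists_le_and_lt_succ_of_tendsto_atTop {u : ℕ → ℕ} (hu : Tendsto u atTop atTop)
    {k₀ n : ℕ} (h : u k₀ ≤ n) : ∃ k, k₀ ≤ k ∧ u k ≤ n ∧ n < u (k + 1) := by
  classical
  have hex : ∃ i, n < u (k₀ + i + 1) := by
    obtain ⟨N, hN⟩ := eventually_atTop.1 (hu.eventually_gt_atTop n)
    exact ⟨N, hN _ (by omega)⟩
  refine ⟨k₀ + Nat.find hex, by omega, ?_, Nat.find_spec hex⟩
  rcases Nat.eq_zero_or_pos (Nat.find hex) with h0 | h0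
  · rwa [h0]
  · have := Nat.find_min hex (Nat.sub_lt h0 one_pos)
    rw [add_assoc, Nat.sub_add_cancel (n := Nat.find hex) (m := 1) h0] at this
    omega

theorem ENNReal.ofReal_le_div_natCast {c : ℝ} {n : ℕ} (hn : 0 < n) {a : ℝ≥0∞} (hc : 0 ≤ c)
    (h : ENNReal.ofReal (c * n) ≤ a) : ENNReal.ofReal c ≤ a / n := by
  rw [ENNReal.le_div_iff_mul_le (Or.inl (by exact_mod_cast hn.ne')) (Or.inl (ENNReal.natCast_ne_top n)), ← ENNReal.ofReal_natCast n,
    ← ENNReal.ofReal_mul hc]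
  exact h

theorem ENNReal.div_natCast_le_ofReal {c : ℝ} {n : ℕ} (hn : 0 < n) {a : ℝ≥0∞} (hc : 0 ≤ c)
    (h : a ≤ ENNReal.ofReal (c * n)) : a / n ≤ ENNReal.ofReal c := by
  rw [ENNReal.div_le_iff_le_mul (Or.inl (by exact_mod_cast hn.ne')) (Or.inl (ENNReal.natCast_ne_top n)), ← ENNReal.ofReal_natCast n,
    ← ENNReal.ofReal_mul hc]
  exact h

namespace IsConvergentSeq

variable {α : ℝ} {q : ℕ → ℕ} {p : ℕ → ℤ}

/-- For q_k ≤ n < q_{k+1} the return time is at most q_{k+1}; no exceptional points arise. -/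
theorem upperReturnRate_le (h : IsConvergentSeq α q p) (hα0 : 0 < α) (hα1 : α < 1)
    (hq : ∀ k, convDenom α k = q k) {t : ℝ} (ht : t ∈ Ico (0 : ℝ) 1) :
    upperReturnRate (sturmianShift α) (sturmianCode α t) ≤ rateOne α := by
  refine le_of_forall_gt fun b hb => ?_
  obtain ⟨b', hb1, hb2⟩ := exists_between hb
  refine lt_of_le_of_lt ?_ hb2
  obtain ⟨k₀, hk₀⟩ := eventually_atTop.1 (eventually_lt_of_limsup_lt hb1)
  refine limsup_le_of_le ⟨0, by simp⟩ ?_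
  filter_upwards [eventually_ge_atTop (q k₀)] with n hn
  obtain ⟨k, hk, hk1, hk2⟩ := exists_le_and_lt_succ_of_tendsto_atTop h.tendsto_atTop hn
  have hlt := hk₀ k hk
  rw [hq, hq, ENNReal.ofReal_div_of_pos (by exact_mod_cast h.pos k), ENNReal.ofReal_natCast,
    ENNReal.ofReal_natCast] at hlt
  exact (ENNReal.div_le_div (h.codeReturnTime_le_of_lt hα0 hα1 ht hk2)
    (by exact_mod_cast hk1)).trans hlt.le

theorem le_lowerReturnRate (h : IsConvergentSeq α q p) (hα0 : 0 < α) (hα1 : α < 1)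
    (hq : ∀ k, convDenom α k = q k) {t : ℝ} (ht : t ∈ Ico (0 : ℝ) 1) :
    rateZero α ≤ lowerReturnRate (sturmianShift α) (sturmianCode α t) := by
  refine le_of_forall_lt fun b hb => ?_
  obtain ⟨b', hb1, hb2⟩ := exists_between hb
  refine lt_of_lt_of_le hb1 ?_
  obtain ⟨k₀, hk₀⟩ := eventually_atTop.1 (eventually_lt_of_lt_liminf hb2)
  refine le_liminf_of_le ⟨⊤, by simp⟩ ?_
  have htend : Tendsto (fun k => q (k + 1) + q k) atTop atTop :=
    tendsto_atTop_mono (fun k => Nat.le_add_left _ _) h.tendsto_atTop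
  filter_upwards [eventually_ge_atTop (q (k₀ + 1) + q k₀)] with n hn
  -- Locating n + 1 rather than n matches the hypothesis of `le_codeReturnTime_of_le`; the rate is
  -- then compared at index k + 1.
  obtain ⟨k, hk, hk1, hk2⟩ := exists_le_and_lt_succ_of_tendsto_atTop htend
    (hn.trans (Nat.le_succ n))
  have hlt := hk₀ (k + 1) (by omega)
  have hn' : (n : ℝ) ≤ q (k + 1 + 1) + q (k + 1) - 1 := by
    have : n + 1 ≤ q (k + 1 + 1) + q (k + 1) := by omega
    have : (n : ℝ) + 1 ≤ q (k + 1 + 1) + q (k + 1) := by exact_mod_cast this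
    linarith
  have hpos : (0 : ℝ) < q (k + 1 + 1) + q (k + 1) - 1 := by
    have h1 : (1 : ℝ) ≤ q (k + 1 + 1) := by exact_mod_cast h.pos (k + 1 + 1)
    have h2 : (1 : ℝ) ≤ q (k + 1) := by exact_mod_cast h.pos (k + 1)
    linarith
  rw [hq, hq, ENNReal.ofReal_div_of_pos hpos, ENNReal.ofReal_natCast] at hlt
  refine hlt.le.trans (ENNReal.div_le_div (h.le_codeReturnTime_of_le hα0 hα1 ht hk1) ?_)
  rw [← ENNReal.ofReal_natCast]
  exact ENNReal.ofReal_le_ofReal hn'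

theorem ae_rateOne_le (h : IsConvergentSeq α q p) (hα0 : 0 < α) (hα1 : α < 1)
    (hirr : Irrational α) {M : ℝ} (hM0 : 0 < M) (hM : ∀ k, (q (k + 1) : ℝ) ≤ M * q k)
    (hq : ∀ k, convDenom α k = q k) :
    ∀ᵐ y : UnitAddCircle, ∀ t ∈ Ico (0 : ℝ) 1, (t : UnitAddCircle) = y →
      rateOne α ≤ upperReturnRate (sturmianShift α) (sturmianCode α t) := by
  -- Rational thresholds leave only countably many null sets to discard.
  have hall : ∀ᵐ y : UnitAddCircle, ∀ c d : ℚ, 0 < (c : ℝ) → (c : ℝ) < d →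
      (∃ᶠ k in atTop, (d : ℝ) * q k < q (k + 1)) → ∀ t ∈ Ico (0 : ℝ) 1, (t : UnitAddCircle) = y →
      ∃ᶠ n : ℕ in atTop, ENNReal.ofReal (c * n) ≤ codeReturnTime α t n := by
    simp only [ae_all_iff (ι := ℚ), eventually_imp_distrib_left]
    exact fun c d hc hcd hf =>
      h.ae_frequently_le_codeReturnTime hα0 hα1 hirr hM0 hM hc hcd hf
  filter_upwards [hall] with y hy t ht hty
  by_contra! hlt
  obtain ⟨d, hd0, hd1, hd2⟩ := ENNReal.lt_iff_exists_rat_btwn.1 hlt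
  obtain ⟨c, hc0, hc1, hc2⟩ := ENNReal.lt_iff_exists_rat_btwn.1 hd1
  have hc : (0 : ℝ) < c := by
    by_contra! hc
    rw [Real.toNNReal_of_nonpos hc] at hc1
    simp at hc1
  have hcd : (c : ℝ) < d := by
    by_contra! hc
    exact absurd hc2 (not_lt.2 (ENNReal.coe_le_coe.2 (Real.toNNReal_le_toNNReal hc)))
  have hf : ∃ᶠ k in atTop, (d : ℝ) * q k < q (k + 1) := by
    refine (frequently_lt_of_lt_limsup (by isBoundedDefault) hd2).mono fun k hk => ?_
    have hk' := (ENNReal.ofReal_lt_ofReal_iff_of_nonneg (hc.trans hcd).le).1 hk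
    rwa [hq, hq, lt_div_iff₀ (by exact_mod_cast h.pos k)] at hk'
  have hfr := hy c d hc hcd hf t ht hty
  have hev := eventually_lt_of_limsup_lt hc1 ⟨⊤, by simp⟩
  obtain ⟨n, ⟨h1, h2⟩, h3⟩ := ((hfr.and_eventually hev).and_eventually
    (eventually_gt_atTop 0)).exists
  exact absurd h2 (not_lt.2 (ENNReal.ofReal_le_div_natCast h3 hc.le h1))

theorem ae_le_rateZero (h : IsConvergentSeq α q p) (hα0 : 0 < α) (hα1 : α < 1)
    (hirr : Irrational α) {M : ℝ} (hM0 : 0 < M) (hM : ∀ k, (q (k + 1) : ℝ) ≤ M * q k)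
    (hq : ∀ k, convDenom α k = q k) :
    ∀ᵐ y : UnitAddCircle, ∀ t ∈ Ico (0 : ℝ) 1, (t : UnitAddCircle) = y →
      lowerReturnRate (sturmianShift α) (sturmianCode α t) ≤ rateZero α := by
  have hall : ∀ᵐ y : UnitAddCircle, ∀ c d : ℚ, 0 < (d : ℝ) → (d : ℝ) < c →
      (∃ᶠ k in atTop, q k < (d : ℝ) * ((q (k + 1) : ℝ) + q k - 1)) →
      ∀ t ∈ Ico (0 : ℝ) 1, (t : UnitAddCircle) = y →
      ∃ᶠ n : ℕ in atTop, codeReturnTime α t n ≤ ENNReal.ofReal (c * n) := by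
    simp only [ae_all_iff (ι := ℚ), eventually_imp_distrib_left]
    exact fun c d hd hcd hf =>
      h.ae_frequently_codeReturnTime_le hα0 hα1 hirr hM0 hM hd hcd hf
  filter_upwards [hall] with y hy t ht hty
  by_contra! hlt
  obtain ⟨c, hc0, hc1, hc2⟩ := ENNReal.lt_iff_exists_rat_btwn.1 hlt
  obtain ⟨d, hd0, hd1, hd2⟩ := ENNReal.lt_iff_exists_rat_btwn.1 hc1
  have hd : (0 : ℝ) < d := by
    by_contra! hd
    rw [Real.toNNReal_of_nonpos hd] at hd1
    simp at hd1
  have hcd : (d : ℝ) < c := by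
    by_contra! hc
    exact absurd hd2 (not_lt.2 (ENNReal.coe_le_coe.2 (Real.toNNReal_le_toNNReal hc)))
  have hf : ∃ᶠ k in atTop, q k < (d : ℝ) * ((q (k + 1) : ℝ) + q k - 1) := by
    refine (frequently_lt_of_liminf_lt (by isBoundedDefault) hd1).mono fun k hk => ?_
    have hk' := (ENNReal.ofReal_lt_ofReal_iff hd).1 hk
    have hpos : (0 : ℝ) < q (k + 1) + q k - 1 := by
      have h1 : (1 : ℝ) ≤ q (k + 1) := by exact_mod_cast h.pos (k + 1)
      have h2 : (1 : ℝ) ≤ q k := by exact_mod_cast h.pos k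
      linarith
    rwa [hq, hq, div_lt_iff₀ hpos] at hk'
  have hfr := hy c d hd hcd hf t ht hty
  have hev := eventually_lt_of_lt_liminf hc2 ⟨0, by simp⟩
  obtain ⟨n, ⟨h1, h2⟩, h3⟩ := ((hfr.and_eventually hev).and_eventually
    (eventually_gt_atTop 0)).exists
  exact absurd h2 (not_lt.2 (ENNReal.div_natCast_le_ofReal h3 (hd.trans hcd).le h1))

end IsConvergentSeq

theorem mainTheorem3 (α : ℝ) (hα0 : 0 < α) (hα1 : α < 1) (hirr : Irrational α)
    (hbdd : HasBoundedPartialQuotients α) :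
    (∃! μ : Measure (ℕ → Fin 2), IsInvariantProbability (sturmianShift α) μ) ∧
    ∀ μ : Measure (ℕ → Fin 2), IsInvariantProbability (sturmianShift α) μ →
      ∀ᵐ x ∂μ, lowerReturnRate (sturmianShift α) x = rateZero α ∧
        upperReturnRate (sturmianShift α) x = rateOne α := by
  obtain ⟨q, p, hq, h, M, hM0, hM⟩ := exists_isConvergentSeq hα0 hα1 hirr hbdd
  refine ⟨⟨_, isInvariantProbability_map_circleCode α, fun μ hμ =>
    hμ.eq_map_circleCode h hα0 hα1 hirr⟩, fun μ hμ => ?_⟩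
  obtain ⟨hvol, hae⟩ := hμ.map_codedPoint h hα0 hα1 hirr
  have hm : Measurable fun x => (codedPoint α x : UnitAddCircle) :=
    AddCircle.measurable_mk'.comp (measurable_codedPoint α)
  have h0 := h.ae_le_rateZero hα0 hα1 hirr hM0 hM hq
  have h1 := h.ae_rateOne_le hα0 hα1 hirr hM0 hM hq
  -- Almost-everywhere statements on the circle pull back to μ, since μ projects to Lebesgue
  -- measure.
  rw [← hvol] at h0 h1
  filter_upwards [hae, ae_of_ae_map hm.aemeasurable h0, ae_of_ae_map hm.aemeasurable h1] with
    x ⟨hx01, hx⟩ hx0 hx1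
  have hx0 := hx0 _ hx01 rfl
  have hx1 := hx1 _ hx01 rfl
  have hx2 := h.le_lowerReturnRate hα0 hα1 hq hx01
  have hx3 := h.upperReturnRate_le hα0 hα1 hq hx01
  rw [hx] at hx0 hx1 hx2 hx3
  exact ⟨le_antisymm hx0 hx2, le_antisymm hx3 hx1⟩
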